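/- Let $\mathbb T=\mathbb R/\mathbb Z$, let $d,r\in\mathbb N$, let $m$ be Haar probability measure on $\mathbb T^d$, and let $\alpha\in\mathbb T^d$, $\beta\in\mathbb T^r$ be generating, i.e. $\{n\alpha:n\in\mathbb Z\}$ is dense in $\mathbb T^d$ and $\{n\beta:n\in\mathbb Z\}$ is dense in $\mathbb T^r$. Define $S:\mathbb T^d\times\mathbb T^d\to\mathbb T^d\times\mathbb T^d$ by $S(x,y)=(x+2\alpha,\,y+x)$. A joining of $\mathbb T^d$ with $\mathbb T^r$ is a closed subgroup of $\mathbb T^d\times\mathbb T^r$ whose projections to $\mathbb T^d$ and to $\mathbb T^r$ are both surjective. An affine joining $\Gamma$ of $\mathbb T^d$ with $\mathbb T^r$ consists of a joining $\Gamma_0$, finitely many cosets $\Gamma_j$ of $\Gamma_0$, and weights $c_j\in[0,1]$ with $\sum_j c_j=1$; integration over $\Gamma$ is defined by $\int F\,dm_\Gamma:=\sum_j c_j\int F\,dm_{\Gamma_j}$, where $m_{\Gamma_j}$ is the translate to $\Gamma_j$ of Haar probability measure on $\Gamma_0$. For $f:\mathbb T^d\times\mathbb T^d\to\mathbb R$ and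 $g:\mathbb T^r\to\mathbb R$, write $$(f*_\Gamma g)(x,y):=\int f(x,y+2w_1)\,g(w_2)\,dm_\Gamma(w),\qquad w=(w_1,w_2)\in\mathbb T^d\times\mathbb T^r.$$ Then there is an affine joining $\Gamma$ of $\mathbb T^d$ with $\mathbb T^r$ such that for all Riemann integrable $g:\mathbb T^r\to\mathbb R$ and all bounded (Borel) measurable $f:\mathbb T^d\times\mathbb T^d\to\mathbb R$, $$\lim_{N\to\infty}\frac1N\sum_{n=1}^N g(n^2\beta)\int f\cdot f\circ S^n\cdot f\circ S^{2n}\,d(m\times m)=\int f(x,y)\,f(x+s,y+t)\,(f*_\Gamma g)(x+2s,y+2t)\,ds\,dt\,dx\,dy,$$ the last integral being over $(\mathbb T^d)^4$ with respect to Haar probability measure (in particular, the limit exists). -/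

import Mathlib

open MeasureTheory Filter Topology

/-- The torus `𝕋ⁿ = (ℝ/ℤ)ⁿ`. Its `volume` is Haar probability measure (product of the Haar
probability measures on the factors). -/
abbrev Torus (n : ℕ) : Type := Fin n → UnitAddCircle

/-- `a` generates the topological group `Z`: the cyclic subgroup `{n a : n ∈ ℤ}` is dense. -/
def Generates {Z : Type*} [AddCommGroup Z] [TopologicalSpace Z] (a : Z) : Prop :=
  Dense (Set.range fun n : ℤ => n • a)

section Joinings

/-- A subgroup `Γ` of `Z × W` is a joining of `Z` with `W` if it is closed and projects onto both
factors. -/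
structure IsJoining {Z W : Type*} [AddCommGroup Z] [TopologicalSpace Z]
    [AddCommGroup W] [TopologicalSpace W] (Γ : AddSubgroup (Z × W)) : Prop where
  isClosed : IsClosed (Γ : Set (Z × W))
  fst_surj : ∀ z : Z, ∃ w ∈ Γ, w.1 = z
  snd_surj : ∀ z : W, ∃ w ∈ Γ, w.2 = z

/-- Haar probability measure of the coset `H + t` of a closed subgroup `H` of a compact group `G`,
as a measure on `G`: the image of Haar probability measure of `H` (the Haar measure giving the
whole of `H` mass one) under `x ↦ x + t`. -/
noncomputable def cosetHaar {G : Type*} [AddCommGroup G] [TopologicalSpace G]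
    [IsTopologicalAddGroup G] [CompactSpace G] [MeasurableSpace G] [BorelSpace G]
    (H : AddSubgroup G) (hH : IsClosed (H : Set G)) (t : G) : Measure G :=
  haveI : CompactSpace H := isCompact_iff_compactSpace.mp hH.isCompact
  (Measure.addHaarMeasure (⊤ : TopologicalSpace.PositiveCompacts H)).map
    fun x : H => (x : G) + t

/-- An affine joining of `Z` with `W`: a joining `Γ₀`, finitely many cosets `Γ₀ + shift j`, and
weights `c j ∈ [0,1]` of sum one. -/
structure AffineJoining (Z W : Type*) [AddCommGroup Z] [TopologicalSpace Z]
    [AddCommGroup W] [TopologicalSpace W] where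
  base : AddSubgroup (Z × W)
  isJoining : IsJoining base
  k : ℕ
  shift : Fin k → Z × W
  c : Fin k → ℝ
  c_mem : ∀ j, c j ∈ Set.Icc (0 : ℝ) 1
  c_sum : ∑ j, c j = 1

/-- Integration over an affine joining: `∫ F dm_Γ = ∑ⱼ cⱼ ∫ F dm_{Γⱼ}`. -/
noncomputable def AffineJoining.integral {Z W : Type*}
    [AddCommGroup Z] [TopologicalSpace Z] [IsTopologicalAddGroup Z] [CompactSpace Z]
    [AddCommGroup W] [TopologicalSpace W] [IsTopologicalAddGroup W] [CompactSpace W]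
    [MeasurableSpace (Z × W)] [BorelSpace (Z × W)]
    (Γ : AffineJoining Z W) (F : Z × W → ℝ) : ℝ :=
  ∑ j, Γ.c j * ∫ w, F w ∂(cosetHaar Γ.base Γ.isJoining.isClosed (Γ.shift j))

/-- `(f *_Γ g)(x, y) = ∫ f(x, y + 2 π₁(w)) g(π₂(w)) dm_Γ(w)`. -/
noncomputable def AffineJoining.conv {d r : ℕ} (Γ : AffineJoining (Torus d) (Torus r))
    (f : Torus d × Torus d → ℝ) (g : Torus r → ℝ) : Torus d × Torus d → ℝ :=
  fun p => Γ.integral fun w => f (p.1, p.2 + 2 • w.1) * g w.2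

end Joinings

/-- The unit box with corners `(0,…,0)` and `(1,…,1)`. -/
def unitBox (r : ℕ) : BoxIntegral.Box (Fin r) where
  lower := fun _ => 0
  upper := fun _ => 1
  lower_lt_upper := fun _ => zero_lt_one

/-- `g : 𝕋ʳ → ℝ` is Riemann integrable: its lift to the unit cube is Riemann integrable, i.e. the
Riemann sums over tagged box partitions converge as the mesh tends to `0`. -/
def RiemannIntegrableOnTorus {r : ℕ} (g : Torus r → ℝ) : Prop :=
  BoxIntegral.Integrable (unitBox r) BoxIntegral.IntegrationParams.Riemann
    (fun x : Fin r → ℝ => g fun i => (x i : UnitAddCircle))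
    (BoxIntegral.BoxAdditiveMap.volume : BoxIntegral.BoxAdditiveMap (Fin r) (ℝ →L[ℝ] ℝ) ⊤)

/-- The map `S(x, y) = (x + 2α, y + x)` on `𝕋ᵈ × 𝕋ᵈ`. -/
def weylMap {d : ℕ} (α : Torus d) : Torus d × Torus d → Torus d × Torus d :=
  fun p => (p.1 + 2 • α, p.2 + p.1)

/-! For p = (x, y), the first coordinates of p, Sⁿp, S²ⁿp are x, x + s, x + 2s with s = 2nα, and the
second coordinates are y, y + t, y + 2t + 2w₁ with t = nx + (n² - n)α and w₁ = n²α. The claim behind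
the theorem is that, for p random and n averaged over 1, …, N, the variables y, x, t, s become Haar
distributed, independent of each other and of w = n²(α, β), while w equidistributes along an affine
joining Γ. The right-hand side is then the integral of f ⊗ f ⊗ f ⊗ g against the limit law.

By Weyl's criterion the claim is tested on characters, which split as q(y) + a(x) + b(t) + e(s) +
ω(w) (`exists_decomposition`). Integrating over p kills the n-th term unless q = 0 and a + nb = 0.
Since the dual of a torus is torsion-free, b ≠ 0 allows at most one such n. If q = a = b = 0, what
remains is a Weyl sum with phase 2n e(α) + n² ω(α, β). It tends to 0 when e ≠ 0, because e(α) then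
has infinite order (`tendsto_cesaro_weyl`). When e = 0 it is the equidistribution of n²(α, β) along
Γ.

To build Γ, put γ = (α, β) and let q now be an exponent for the torsion of the finitely generated
group of values ω(γ). The base is the closure of ℤqγ, and the cosets are those of j²γ for j mod q,
with equal weights. Characters with qω(γ) = 0 give q-periodic sequences; for all others ω(γ) has
infinite order and Weyl's theorem applies (`tendsto_cesaro_squaresJoining`).

Weak convergence only treats continuous f and g. Since S preserves m × m, each of the three points
has law m × m before and after the limit, so bounded measurable f follows by L¹ approximation
(`tendsto_integral_orbitMeasure`). A Riemann integrable g is bounded and continuous almost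
everywhere, hence squeezed between continuous functions with nearly equal integrals, and n²β
equidistributes for Haar measure (`tendsto_weighted_average`). -/

set_option linter.unusedSectionVars false

/-! ### Cesàro means and Weyl's estimate for quadratic phases -/

section WeylSums

/-- The Cesàro mean of `u 1, …, u N`. -/
noncomputable def cesaro (u : ℕ → ℂ) (N : ℕ) : ℂ := (1 / (N : ℂ)) * ∑ n ∈ Finset.Icc 1 N, u n

/-- The standard character `θ ↦ exp (2πiθ)` of `ℝ/ℤ`, with complex values. -/
noncomputable def expCircle (θ : UnitAddCircle) : ℂ := (AddCircle.toCircle θ : Circle)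

lemma expCircle_zero : expCircle 0 = 1 := by simp [expCircle]

lemma expCircle_add (a b : UnitAddCircle) : expCircle (a + b) = expCircle a * expCircle b := by
  simp [expCircle, AddCircle.toCircle_add]

lemma norm_expCircle (a : UnitAddCircle) : ‖expCircle a‖ = 1 := Circle.norm_coe _

lemma expCircle_neg (a : UnitAddCircle) : expCircle (-a) = star (expCircle a) := by
  rw [expCircle, AddCircle.toCircle_neg, Circle.coe_inv_eq_conj]
  rfl

lemma expCircle_eq_one {a : UnitAddCircle} : expCircle a = 1 ↔ a = 0 := by
  constructor
  · intro h
    apply AddCircle.injective_toCircle (T := (1 : ℝ)) one_ne_zero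
    ext
    simpa [expCircle] using h
  · rintro rfl
    exact expCircle_zero

lemma continuous_expCircle : Continuous expCircle :=
  continuous_subtype_val.comp AddCircle.continuous_toCircle

lemma sum_Icc_one_eq_sum_range {M : Type*} [AddCommMonoid M] (u : ℕ → M) (N : ℕ) :
    ∑ n ∈ Finset.Icc 1 N, u n = ∑ n ∈ Finset.range N, u (n + 1) := by
  rw [Finset.range_eq_Ico, Finset.sum_Ico_add' u 0 N 1]
  rfl

lemma tendsto_cesaro_zero_of_bounded {u : ℕ → ℂ} {C : ℝ}
    (h : ∀ N, ‖∑ n ∈ Finset.range N, u (n + 1)‖ ≤ C) : Tendsto (cesaro u) atTop (𝓝 0) := by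
  refine squeeze_zero_norm (a := fun N : ℕ => C / N) (fun N => ?_)
    (tendsto_const_div_atTop_nhds_zero_nat C)
  rw [cesaro, sum_Icc_one_eq_sum_range, norm_mul, norm_div, norm_one, Complex.norm_natCast,
    one_div, inv_mul_eq_div]
  gcongr
  exact h N

/-- Shifting the range of summation changes a sum of terms of norm at most one by a bounded
amount. -/
lemma norm_sum_shift_sub_le {u : ℕ → ℂ} (hu : ∀ n, ‖u n‖ ≤ 1) (h N : ℕ) :
    ‖∑ n ∈ Finset.range N, u (n + h) - ∑ n ∈ Finset.range N, u n‖ ≤ 2 * h := by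
  have e : ∑ n ∈ Finset.range N, u (n + h) - ∑ n ∈ Finset.range N, u n =
      ∑ n ∈ Finset.range h, u (N + n) - ∑ n ∈ Finset.range h, u n := by
    have h1 := Finset.sum_range_add u N h
    have h2 := Finset.sum_range_add u h N
    rw [add_comm h N] at h2
    simp_rw [fun n => add_comm n h]
    linear_combination h1 - h2
  rw [e]
  have b1 : ‖∑ n ∈ Finset.range h, u (N + n)‖ ≤ h := by
    simpa using norm_sum_le_of_le (Finset.range h) (fun n _ => hu (N + n))
  have b2 : ‖∑ n ∈ Finset.range h, u n‖ ≤ h := by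
    simpa using norm_sum_le_of_le (Finset.range h) (fun n _ => hu n)
  linarith [norm_sub_le (∑ n ∈ Finset.range h, u (N + n)) (∑ n ∈ Finset.range h, u n)]

/-- Partial sums of a bounded sequence with `u (n + q) = z * u n`, `z ≠ 1`, are bounded. -/
lemma norm_sum_le_of_quasiperiodic {u : ℕ → ℂ} (hu : ∀ n, ‖u n‖ ≤ 1) {q : ℕ} {z : ℂ} (hz : z ≠ 1)
    (hq : ∀ n, u (n + q) = z * u n) (N : ℕ) :
    ‖∑ n ∈ Finset.range N, u n‖ ≤ 2 * q / ‖z - 1‖ := by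
  have hz' : 0 < ‖z - 1‖ := norm_pos_iff.2 (sub_ne_zero.2 hz)
  have h := norm_sum_shift_sub_le hu q N
  simp_rw [hq, ← Finset.mul_sum] at h
  rw [← sub_one_mul, norm_mul] at h
  rw [le_div_iff₀ hz']
  linarith

lemma tendsto_cesaro_of_quasiperiodic {u : ℕ → ℂ} (hu : ∀ n, ‖u n‖ ≤ 1) {q : ℕ} {z : ℂ}
    (hz : z ≠ 1) (hq : ∀ n, u (n + q) = z * u n) : Tendsto (cesaro u) atTop (𝓝 0) :=
  tendsto_cesaro_zero_of_bounded (norm_sum_le_of_quasiperiodic (u := fun n => u (n + 1))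
    (fun n => hu _) hz fun n => by rw [← hq]; congr 1; ring)

lemma sum_range_add_of_periodic {u : ℕ → ℂ} {q : ℕ} (hq : ∀ n, u (n + q) = u n) (m : ℕ) :
    ∑ n ∈ Finset.range q, u (m + n) = ∑ n ∈ Finset.range q, u n := by
  induction m with
  | zero => simp
  | succ m ih =>
    rw [← ih]
    have h1 := Finset.sum_range_succ (fun n => u (m + n)) q
    have h2 := Finset.sum_range_succ' (fun n => u (m + n)) q
    simp only [add_zero, hq] at h1 h2
    rw [h1] at h2
    rw [add_right_cancel h2]
    exact Finset.sum_congr rfl fun n _ => by congr 1; ring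

/-- Cesàro means of a periodic sequence converge to the mean over a period. -/
lemma tendsto_cesaro_of_periodic {u : ℕ → ℂ} {q : ℕ} (hq0 : 0 < q) (hq : ∀ n, u (n + q) = u n) :
    Tendsto (cesaro u) atTop (𝓝 ((1 / (q : ℂ)) * ∑ j ∈ Finset.range q, u j)) := by
  have hqc : (q : ℂ) ≠ 0 := by exact_mod_cast hq0.ne'
  set c := (1 / (q : ℂ)) * ∑ j ∈ Finset.range q, u j with hc
  let v : ℕ → ℂ := fun n => u n - c
  have hv : ∀ n, v (n + q) = v n := fun n => by simp [v, hq]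
  have hv0 : ∑ n ∈ Finset.range q, v n = 0 := by
    simp only [v, Finset.sum_sub_distrib, Finset.sum_const, Finset.card_range, nsmul_eq_mul, hc]
    field_simp
    ring
  -- The centred sequence sums to zero over a period, so its partial sums are themselves
  -- `q`-periodic, hence bounded.
  let s : ℕ → ℂ := fun N => ∑ n ∈ Finset.range N, v (n + 1)
  have hs : ∀ N, s (N + q) = s N := by
    intro N
    simp only [s]
    rw [Finset.sum_range_add]
    have := sum_range_add_of_periodic hv (N + 1)
    rw [hv0, Finset.sum_congr rfl fun n _ => by rw [add_right_comm]] at this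
    rw [this, add_zero]
  have hmod : ∀ N, s N = s (N % q) := by
    intro N
    exact ((show Function.Periodic s q from hs).map_mod_nat N).symm
  have hb : ∀ N, ‖s N‖ ≤ ∑ j ∈ Finset.range q, ‖s j‖ := by
    intro N
    rw [hmod N]
    exact Finset.single_le_sum (f := fun j => ‖s j‖) (fun _ _ => norm_nonneg _)
      (Finset.mem_range.2 (Nat.mod_lt _ hq0))
  have h0 := (tendsto_cesaro_zero_of_bounded hb).add_const c
  rw [zero_add] at h0
  refine h0.congr' ?_
  filter_upwards [eventually_gt_atTop 0] with N hN
  have hNc : (N : ℂ) ≠ 0 := by exact_mod_cast hN.ne'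
  simp only [cesaro, v, Finset.sum_sub_distrib, Finset.sum_const, Nat.card_Icc, nsmul_eq_mul,
    Nat.add_sub_cancel]
  field_simp
  ring

lemma sq_norm_sum_window (u : ℕ → ℂ) (H N : ℕ) :
    ∑ n ∈ Finset.range N, ‖∑ h ∈ Finset.range H, u (n + h)‖ ^ 2 =
      (∑ h ∈ Finset.range H, ∑ k ∈ Finset.range H,
        ∑ n ∈ Finset.range N, u (n + h) * star (u (n + k))).re := by
  have key : ∀ z : ℂ, ‖z‖ ^ 2 = (z * star z).re := fun z => by
    rw [Complex.star_def, Complex.mul_conj, Complex.ofReal_re, Complex.normSq_eq_norm_sq]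
  simp_rw [key, star_sum, Finset.sum_mul_sum]
  rw [← Complex.re_sum, Finset.sum_comm]
  congr 2
  ext h
  rw [Finset.sum_comm]

/-- The van der Corput inequality. -/
lemma vanDerCorput_bound {u : ℕ → ℂ} (hu : ∀ n, ‖u n‖ ≤ 1)
    {K : ℕ → ℕ → ℝ}
    (hK : ∀ h k, h ≠ k → ∀ N, ‖∑ n ∈ Finset.range N, u (n + h) * star (u (n + k))‖ ≤ K h k)
    (H N : ℕ) :
    H * ‖∑ n ∈ Finset.range N, u n‖ ≤
      2 * H ^ 2 + √(N * (N * H + ∑ h ∈ Finset.range H, ∑ k ∈ Finset.range H, |K h k|)) := by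
  set S := ∑ n ∈ Finset.range N, u n
  set T := ∑ n ∈ Finset.range N, ∑ h ∈ Finset.range H, u (n + h)
  have hT : ‖T - H * S‖ ≤ 2 * H ^ 2 := by
    have : T - H * S = ∑ h ∈ Finset.range H, (∑ n ∈ Finset.range N, u (n + h) - S) := by
      simp only [T, Finset.sum_sub_distrib, Finset.sum_const, Finset.card_range, nsmul_eq_mul]
      rw [Finset.sum_comm]
    rw [this]
    calc _ ≤ ∑ h ∈ Finset.range H, (2 * H : ℝ) := by
          refine norm_sum_le_of_le _ fun h hh => (norm_sum_shift_sub_le hu h N).trans ?_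
          have : (h : ℝ) ≤ H := by exact_mod_cast (Finset.mem_range.1 hh).le
          linarith
      _ = 2 * H ^ 2 := by simp; ring
  -- Cauchy–Schwarz in `n`, then expansion of the square: the `H` diagonal pairs contribute at most
  -- `N` each, the others at most `|K h k|`.
  have hT2 : ‖T‖ ≤ √(N * (N * H + ∑ h ∈ Finset.range H, ∑ k ∈ Finset.range H, |K h k|)) := by
    apply Real.le_sqrt_of_sq_le
    calc ‖T‖ ^ 2 ≤ (∑ n ∈ Finset.range N, ‖∑ h ∈ Finset.range H, u (n + h)‖) ^ 2 := by
          gcongr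
          exact norm_sum_le _ _
      _ ≤ N * ∑ n ∈ Finset.range N, ‖∑ h ∈ Finset.range H, u (n + h)‖ ^ 2 := by
          simpa using sq_sum_le_card_mul_sum_sq (s := Finset.range N)
            (f := fun n => ‖∑ h ∈ Finset.range H, u (n + h)‖)
      _ ≤ _ := by
          gcongr
          rw [sq_norm_sum_window]
          refine (Complex.re_le_norm _).trans ?_
          have hd : (N * H : ℝ) = ∑ h ∈ Finset.range H, ∑ k ∈ Finset.range H,
              if h = k then (N : ℝ) else 0 := by
            rw [Finset.sum_congr rfl (g := fun _ => (N : ℝ))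
              (fun h hh => by rw [Finset.sum_ite_eq, if_pos hh])]
            simp [mul_comm]
          rw [hd, ← Finset.sum_add_distrib]
          refine norm_sum_le_of_le _ fun h _ => ?_
          rw [← Finset.sum_add_distrib]
          refine norm_sum_le_of_le _ fun k _ => ?_
          split_ifs with hk
          · subst hk
            have : ‖∑ n ∈ Finset.range N, u (n + h) * star (u (n + h))‖ ≤ N := by
              refine (norm_sum_le_of_le (f := fun n => u (n + h) * star (u (n + h)))
                (Finset.range N) (n := fun _ => (1 : ℝ)) fun n _ => ?_).trans (by simp)
              rw [norm_mul, norm_star]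
              exact mul_le_one₀ (hu _) (norm_nonneg _) (hu _)
            linarith [abs_nonneg (K h h)]
          · rw [zero_add]
            exact (hK h k hk N).trans (le_abs_self _)
  have : (H : ℝ) * ‖S‖ = ‖(H : ℂ) * S‖ := by rw [norm_mul, Complex.norm_natCast]
  rw [this]
  have h3 := norm_sub_norm_le (H * S) T
  rw [norm_sub_rev] at h3
  linarith

/-- Van der Corput's lemma for sequences whose autocorrelations have bounded partial sums. -/
lemma tendsto_cesaro_of_autocorrelation {u : ℕ → ℂ} (hu : ∀ n, ‖u n‖ ≤ 1)
    {K : ℕ → ℕ → ℝ}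
    (hK : ∀ h k, h ≠ k → ∀ N,
      ‖∑ n ∈ Finset.range N, u (n + 1 + h) * star (u (n + 1 + k))‖ ≤ K h k) :
    Tendsto (cesaro u) atTop (𝓝 0) := by
  rw [tendsto_zero_iff_norm_tendsto_zero]
  rw [Metric.tendsto_nhds]
  intro ε hε
  -- For fixed `H` the van der Corput bound divided by `N * H` tends to `√(1 / H)`, which this
  -- choice makes smaller than `ε`.
  obtain ⟨H, hH⟩ := exists_nat_gt (1 / ε ^ 2)
  have hH0 : (0 : ℝ) < H := lt_trans (by positivity) hH
  set B := ∑ h ∈ Finset.range H, ∑ k ∈ Finset.range H, |K h k|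
  have lim : Tendsto (fun N : ℕ => 2 * H / (N : ℝ) + √(1 / H + (B / H ^ 2) / (N : ℝ))) atTop
      (𝓝 (0 + √(1 / H + 0))) :=
    (tendsto_const_div_atTop_nhds_zero_nat _).add
      (((tendsto_const_div_atTop_nhds_zero_nat _).const_add _).sqrt)
  have hlt : 0 + √(1 / (H : ℝ) + 0) < ε := by
    rw [zero_add, add_zero, Real.sqrt_lt' hε, one_div_lt hH0 (by positivity)]
    exact hH
  filter_upwards [lim.eventually_lt_const hlt, eventually_gt_atTop 0] with N hN hN0
  have hN0' : (0 : ℝ) < N := by exact_mod_cast hN0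
  rw [Real.dist_eq, sub_zero, abs_norm]
  refine lt_of_le_of_lt ?_ hN
  have hb := vanDerCorput_bound (u := fun n => u (n + 1)) (fun n => hu _) (K := K)
    (fun h k hk N => by simpa only [add_right_comm] using hK h k hk N) H N
  rw [cesaro, sum_Icc_one_eq_sum_range, norm_mul, norm_div, norm_one, Complex.norm_natCast]
  set s := ‖∑ n ∈ Finset.range N, u (n + 1)‖
  have e : √((N : ℝ) * (N * H + B)) = N * H * √(1 / H + B / H ^ 2 / N) := by
    rw [← Real.sqrt_sq (by positivity : (0 : ℝ) ≤ N * H), ← Real.sqrt_mul (by positivity),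
      Real.sqrt_sq (by positivity)]
    congr 1
    field_simp
  rw [e] at hb
  have : 1 / (N : ℝ) * s = (H * s) / (N * H) := by field_simp
  rw [this, div_le_iff₀ (by positivity)]
  refine hb.trans (le_of_eq ?_)
  field_simp

/-- Weyl: quadratic exponential sums with leading coefficient of infinite order are `o(N)`. -/
lemma tendsto_cesaro_quadratic {θ : UnitAddCircle} (hθ : ∀ n : ℕ, 0 < n → n • θ ≠ 0)
    (φ : UnitAddCircle) :
    Tendsto (cesaro fun n => expCircle (n • φ + n ^ 2 • θ)) atTop (𝓝 0) := by
  -- The autocorrelation at shifts `h`, `k` has phase linear in `n`: it is a geometric sequence of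
  -- ratio `expCircle (2 (h - k) θ)`, and this ratio is not 1.
  have hne : ∀ h k : ℕ, h ≠ k → expCircle (((2 * h : ℤ) - 2 * k) • θ) ≠ 1 := by
    intro h k hk
    rw [Ne, expCircle_eq_one]
    intro h0
    have h1 : (2 * (h : ℤ) - 2 * k).natAbs • θ = 0 := by
      rw [← natCast_zsmul]
      rcases Int.natAbs_eq (2 * (h : ℤ) - 2 * k) with h2 | h2
      · rw [← h2, h0]
      · rw [show ((2 * (h : ℤ) - 2 * k).natAbs : ℤ) = -(2 * (h : ℤ) - 2 * k) by omega, neg_smul,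
          h0, neg_zero]
    exact hθ _ (by omega) h1
  refine tendsto_cesaro_of_autocorrelation (fun n => (norm_expCircle _).le)
    (K := fun h k => 2 * (1 : ℕ) / ‖expCircle (((2 * h : ℤ) - 2 * k) • θ) - 1‖)
    fun h k hk N => ?_
  refine norm_sum_le_of_quasiperiodic (fun n => ?_) (hne h k hk) (fun n => ?_) N
  · rw [norm_mul, norm_star, norm_expCircle, norm_expCircle, one_mul]
  · simp only [← expCircle_neg, ← expCircle_add]
    congr 1
    simp only [← natCast_zsmul]
    push_cast
    module

/-- Weyl sums with leading coefficient of finite order and linear coefficient of infinite order. -/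
lemma tendsto_cesaro_of_torsion_quadratic {θ φ : UnitAddCircle} {q : ℕ} (hq : 0 < q)
    (hθ : q • θ = 0) (hφ : ∀ n : ℕ, 0 < n → n • φ ≠ 0) :
    Tendsto (cesaro fun n => expCircle (n • φ + n ^ 2 • θ)) atTop (𝓝 0) := by
  refine tendsto_cesaro_of_quasiperiodic (fun n => (norm_expCircle _).le) (q := q)
    (z := expCircle (q • φ)) (fun h => hφ q hq (expCircle_eq_one.1 h)) fun n => ?_
  rw [← expCircle_add]
  congr 1
  have : ((n + q) ^ 2) • θ = n ^ 2 • θ := by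
    rw [show (n + q) ^ 2 = n ^ 2 + (2 * n + q) * q by ring, add_smul, mul_smul, hθ, smul_zero,
      add_zero]
  rw [this, add_smul]
  abel

/-- If `θ` has infinite order, the quadratic term alone forces cancellation. If `q • θ = 0`, the
quadratic term is `q`-periodic and each shift by `q` multiplies the sequence by `expCircle (q • φ) ≠
1`. -/
lemma tendsto_cesaro_weyl {θ φ : UnitAddCircle} (hφ : ∀ n : ℕ, 0 < n → n • φ ≠ 0) :
    Tendsto (cesaro fun n => expCircle (n • φ + n ^ 2 • θ)) atTop (𝓝 0) := by
  by_cases h : ∀ n : ℕ, 0 < n → n • θ ≠ 0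
  · exact tendsto_cesaro_quadratic h φ
  · push Not at h
    obtain ⟨q, hq, hq0⟩ := h
    exact tendsto_cesaro_of_torsion_quadratic hq hq0 hφ

end WeylSums

/-! ### Characters: orthogonality, density of their span, Weyl's criterion -/

section Characters

lemma exists_nsmul_eq_torus {n : ℕ} {q : ℕ} (hq : 0 < q) (x : Torus n) : ∃ y, q • y = x := by
  have h : ∀ a : UnitAddCircle, ∃ b, q • b = a := by
    intro a
    induction a using QuotientAddGroup.induction_on with
    | H t =>
      refine ⟨((t / q : ℝ) : UnitAddCircle), ?_⟩
      rw [← AddCircle.coe_nsmul, nsmul_eq_mul, mul_div_cancel₀]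
      exact_mod_cast hq.ne'
  choose b hb using fun i => h (x i)
  exact ⟨b, funext hb⟩

/-- Tori are divisible, so homomorphisms out of them form a torsion-free group. -/
lemma addMonoidHom_torus_eq_zero_of_nsmul {n : ℕ} {A : Type*} [AddCommGroup A] {q : ℕ}
    (hq : 0 < q) (ψ : Torus n →+ A) (h : ∀ x, q • ψ x = 0) : ψ = 0 := by
  refine DFunLike.ext _ _ fun x => ?_
  obtain ⟨y, rfl⟩ := exists_nsmul_eq_torus hq x
  rw [map_nsmul, h, AddMonoidHom.zero_apply]

/-- A nontrivial character of a torus takes a value of infinite order at a generator. -/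
lemma nsmul_apply_generator_ne_zero {n : ℕ} {α : Torus n} (hα : Generates α)
    {ψ : Torus n →+ UnitAddCircle} (hc : Continuous ψ) (h0 : ψ ≠ 0) (q : ℕ) (hq : 0 < q) :
    q • ψ α ≠ 0 := by
  intro h
  apply h0
  apply addMonoidHom_torus_eq_zero_of_nsmul hq
  have hcl : IsClosed {x | q • ψ x = 0} := isClosed_eq (hc.const_smul q) continuous_const
  have hsub : Set.range (fun m : ℤ => m • α) ⊆ {x | q • ψ x = 0} := by
    rintro _ ⟨m, rfl⟩
    simp only [Set.mem_ofPred_eq, map_zsmul]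
    rw [smul_comm, h, smul_zero]
  intro x
  exact hcl.closure_subset_iff.2 hsub (hα x)

/-- Translating by a point `a` with `ψ a ≠ 0` multiplies the integral by `expCircle (ψ a) ≠ 1`, yet
leaves it unchanged. -/
lemma integral_expCircle_eq_zero {Y : Type*} [AddCommGroup Y] [MeasurableSpace Y] [MeasurableAdd Y] (μ : Measure Y)
    [μ.IsAddLeftInvariant] {ψ : Y →+ UnitAddCircle} (h : ψ ≠ 0) :
    ∫ y, expCircle (ψ y) ∂μ = 0 := by
  obtain ⟨a, ha⟩ := DFunLike.ne_iff.1 h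
  have h1 := integral_add_left_eq_self (μ := μ) (fun y => expCircle (ψ y)) a
  simp only [map_add, expCircle_add, integral_const_mul] at h1
  have h2 : expCircle (ψ a) ≠ 1 := fun h2 => ha (by simpa using expCircle_eq_one.1 h2)
  have h3 : (expCircle (ψ a) - 1) * ∫ y, expCircle (ψ y) ∂μ = 0 := by
    rw [sub_mul, h1, one_mul, sub_self]
  exact (mul_eq_zero.1 h3).resolve_left (sub_ne_zero.2 h2)

lemma integral_expCircle_eq_ite {Y : Type*} [AddCommGroup Y] [MeasurableSpace Y] [MeasurableAdd Y] (μ : Measure Y)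
    [μ.IsAddLeftInvariant] [IsProbabilityMeasure μ] (ψ : Y →+ UnitAddCircle) [Decidable (ψ = 0)] :
    ∫ y, expCircle (ψ y) ∂μ = if ψ = 0 then 1 else 0 := by
  split_ifs with h
  · subst h
    simp [expCircle_zero]
  · exact integral_expCircle_eq_zero μ h

variable {Y : Type*} [AddCommGroup Y] [TopologicalSpace Y]

/-- The continuous function `y ↦ exp (2πi ψ y)` attached to a continuous character. -/
noncomputable def expChar (ψ : Y →+ UnitAddCircle) (hψ : Continuous ψ) : C(Y, ℂ) :=
  ⟨fun y => expCircle (ψ y), continuous_expCircle.comp hψ⟩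

/-- The exponentials of the members of a set of characters. -/
def expChars (D : Set (Y →+ UnitAddCircle)) : Set C(Y, ℂ) :=
  {F | ∃ ψ ∈ D, ∀ y, F y = expCircle (ψ y)}

/-- Stone–Weierstrass: a group of continuous characters that separates points spans a dense
subspace of the continuous functions. -/
theorem span_expChars_dense [CompactSpace Y] (D : AddSubgroup (Y →+ UnitAddCircle))
    (hD : ∀ ψ ∈ D, Continuous ψ) (hsep : ∀ x y : Y, x ≠ y → ∃ ψ ∈ D, ψ x ≠ ψ y) :
    (Submodule.span ℂ (expChars (D : Set (Y →+ UnitAddCircle)))).topologicalClosure = ⊤ := by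
  set V := Submodule.span ℂ (expChars (D : Set (Y →+ UnitAddCircle)))
  have one_mem : (1 : C(Y, ℂ)) ∈ V :=
    Submodule.subset_span ⟨0, D.zero_mem, fun y => by simp [expCircle_zero]⟩
  have mul_mem : ∀ f g, f ∈ V → g ∈ V → f * g ∈ V := by
    intro f g hf hg
    refine Submodule.span_induction₂ (p := fun f g _ _ => f * g ∈ V) ?_ ?_ ?_ ?_ ?_ ?_ ?_ hf hg
    · rintro f g ⟨ψ, hψ, hf⟩ ⟨χ, hχ, hg⟩
      exact Submodule.subset_span ⟨ψ + χ, D.add_mem hψ hχ, fun y => by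
        simp [hf, hg, expCircle_add]⟩
    · intro g _; simp
    · intro g _; simp
    · intro f g h _ _ _ h1 h2; rw [add_mul]; exact V.add_mem h1 h2
    · intro f g h _ _ _ h1 h2; rw [mul_add]; exact V.add_mem h1 h2
    · intro r f g _ _ h; rw [smul_mul_assoc]; exact V.smul_mem _ h
    · intro r f g _ _ h; rw [mul_smul_comm]; exact V.smul_mem _ h
  let A : StarSubalgebra ℂ C(Y, ℂ) :=
    { V.toSubalgebra one_mem mul_mem with
      star_mem' := by
        intro f hf
        change star f ∈ V
        refine Submodule.span_induction (p := fun f _ => star f ∈ V) ?_ ?_ ?_ ?_ hf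
        · rintro f ⟨ψ, hψ, hf⟩
          exact Submodule.subset_span ⟨-ψ, D.neg_mem hψ, fun y => by
            simp [hf, expCircle_neg]⟩
        · simp
        · intro f g _ _ h1 h2; rw [star_add]; exact V.add_mem h1 h2
        · intro r f _ h; rw [star_smul]; exact V.smul_mem _ h }
  have hA : A.SeparatesPoints := by
    intro x y hxy
    obtain ⟨ψ, hψ, hne⟩ := hsep x y hxy
    refine ⟨expChar ψ (hD ψ hψ), ⟨expChar ψ (hD ψ hψ),
      Submodule.subset_span ⟨ψ, hψ, fun y => rfl⟩, rfl⟩, fun h => hne ?_⟩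
    have h' : expCircle (ψ x) = expCircle (ψ y) := h
    rw [← sub_eq_zero, ← expCircle_eq_one, sub_eq_add_neg, expCircle_add, h', ← expCircle_add,
      add_neg_cancel, expCircle_zero]
  have key := ContinuousMap.starSubalgebra_topologicalClosure_eq_top_of_separatesPoints A hA
  rw [eq_top_iff]
  intro f _
  have : f ∈ A.topologicalClosure := by rw [key]; trivial
  exact this

/-- A separating group of continuous characters contains every continuous character. -/
theorem mem_of_separating [IsTopologicalAddGroup Y] [CompactSpace Y] [MeasurableSpace Y]
    [BorelSpace Y] [MeasurableAdd Y] (μ : Measure Y)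
    [μ.IsAddLeftInvariant] [IsProbabilityMeasure μ] (D : AddSubgroup (Y →+ UnitAddCircle))
    (hD : ∀ ψ ∈ D, Continuous ψ) (hsep : ∀ x y : Y, x ≠ y → ∃ ψ ∈ D, ψ x ≠ ψ y)
    (χ : Y →+ UnitAddCircle) (hχ : Continuous χ) : χ ∈ D := by
  by_contra hn
  have hint : ∀ F : C(Y, ℂ), Integrable (fun y => expCircle (-χ y) * F y) μ := fun F =>
    Continuous.integrable_of_hasCompactSupport
      ((continuous_expCircle.comp hχ.neg).mul F.continuous) (HasCompactSupport.of_compactSpace _)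
  -- If `χ ∉ D`, then `χ` is orthogonal to every member of `D`. Pairing with its conjugate vanishes
  -- on a dense subspace but equals 1 at `χ`, a contradiction.
  have hV : ∀ F ∈ Submodule.span ℂ (expChars (D : Set (Y →+ UnitAddCircle))),
      ∫ y, expCircle (-χ y) * F y ∂μ = 0 := by
    intro F hF
    induction hF using Submodule.span_induction with
    | mem F h =>
      obtain ⟨ψ, hψ, hF⟩ := h
      have h1 : ∀ y, expCircle (-χ y) * F y = expCircle ((ψ - χ) y) := fun y => by
        rw [hF, ← expCircle_add, AddMonoidHom.sub_apply]
        congr 1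
        abel
      simp_rw [h1]
      apply integral_expCircle_eq_zero
      intro h0
      rw [sub_eq_zero] at h0
      exact hn (h0 ▸ hψ)
    | zero => simp
    | add F G _ _ h1 h2 =>
      simp only [ContinuousMap.add_apply, mul_add]
      rw [integral_add (hint F) (hint G), h1, h2, add_zero]
    | smul r F _ h =>
      simp only [ContinuousMap.smul_apply, smul_eq_mul, mul_left_comm]
      rw [integral_const_mul, h, mul_zero]
  have hmem : expChar χ hχ ∈ closure
      (Submodule.span ℂ (expChars (D : Set (Y →+ UnitAddCircle))) : Set C(Y, ℂ)) := by
    have := span_expChars_dense D hD hsep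
    rw [← Submodule.topologicalClosure_coe, this]
    trivial
  obtain ⟨P, hP, hd⟩ := Metric.mem_closure_iff.1 hmem (1 / 2) (by norm_num)
  have h1 : ∫ y, expCircle (-χ y) * (expChar χ hχ - P) y ∂μ = 1 := by
    simp only [ContinuousMap.sub_apply, mul_sub]
    rw [integral_sub (hint _) (hint _), hV P hP, sub_zero]
    have : ∀ y, expCircle (-χ y) * (expChar χ hχ) y = 1 := fun y => by
      change expCircle (-χ y) * expCircle (χ y) = 1
      rw [← expCircle_add, neg_add_cancel, expCircle_zero]
    simp [this]
  have h2 : ‖∫ y, expCircle (-χ y) * (expChar χ hχ - P) y ∂μ‖ ≤ 1 / 2 := by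
    refine (norm_integral_le_of_norm_le_const (C := 1 / 2) (.of_forall fun y => ?_)).trans (by simp)
    rw [norm_mul, norm_expCircle, one_mul]
    rw [dist_eq_norm] at hd
    exact ((expChar χ hχ - P).norm_coe_le_norm y).trans hd.le
  rw [h1] at h2
  norm_num at h2

/-- Weyl's criterion: convergence of the integrals of characters implies weak convergence. -/
theorem tendsto_integral_of_characters [IsTopologicalAddGroup Y] [CompactSpace Y]
    [MeasurableSpace Y] [BorelSpace Y]
    (hsep : ∀ x y : Y, x ≠ y → ∃ ψ : Y →+ UnitAddCircle, Continuous ψ ∧ ψ x ≠ ψ y)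
    {μs : ℕ → Measure Y} {μ : Measure Y} [∀ N, IsFiniteMeasure (μs N)] [IsFiniteMeasure μ]
    (hμs : ∀ N, (μs N).real Set.univ ≤ 1) (hμ : μ.real Set.univ ≤ 1)
    (h : ∀ ψ : Y →+ UnitAddCircle, Continuous ψ →
      Tendsto (fun N => ∫ y, expCircle (ψ y) ∂μs N) atTop (𝓝 (∫ y, expCircle (ψ y) ∂μ)))
    {F : Y → ℝ} (hF : Continuous F) :
    Tendsto (fun N => ∫ y, F y ∂μs N) atTop (𝓝 (∫ y, F y ∂μ)) := by
  let D : AddSubgroup (Y →+ UnitAddCircle) :=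
    { carrier := {ψ | Continuous ψ}
      zero_mem' := continuous_const
      add_mem' := fun h1 h2 => h1.add h2
      neg_mem' := fun h1 => h1.neg }
  have hD := span_expChars_dense D (fun ψ hψ => hψ) hsep
  have hint : ∀ (ν : Measure Y) [IsFiniteMeasure ν] (F : C(Y, ℂ)), Integrable F ν := fun ν _ F =>
    Continuous.integrable_of_hasCompactSupport F.continuous (HasCompactSupport.of_compactSpace _)
  have hV : ∀ F ∈ Submodule.span ℂ (expChars (D : Set (Y →+ UnitAddCircle))),
      Tendsto (fun N => ∫ y, F y ∂μs N) atTop (𝓝 (∫ y, F y ∂μ)) := by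
    intro F hF
    induction hF using Submodule.span_induction with
    | mem F hF =>
      obtain ⟨ψ, hψ, hF⟩ := hF
      simp_rw [hF]
      exact h ψ hψ
    | zero => simp
    | add F G _ _ h1 h2 =>
      simp only [ContinuousMap.add_apply]
      simp_rw [fun (ν : Measure Y) [IsFiniteMeasure ν] => integral_add (hint ν F) (hint ν G)]
      exact h1.add h2
    | smul r F _ h =>
      simp only [ContinuousMap.smul_apply, smul_eq_mul, integral_const_mul]
      exact h.const_mul r
  have hC : ∀ F : C(Y, ℂ), Tendsto (fun N => ∫ y, F y ∂μs N) atTop (𝓝 (∫ y, F y ∂μ)) := by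
    intro F
    have hmem : F ∈ closure
        (Submodule.span ℂ (expChars (D : Set (Y →+ UnitAddCircle))) : Set C(Y, ℂ)) := by
      rw [← Submodule.topologicalClosure_coe, hD]
      trivial
    rw [Metric.tendsto_nhds]
    intro ε hε
    obtain ⟨P, hP, hd⟩ := Metric.mem_closure_iff.1 hmem (ε / 3) (by positivity)
    have hb : ∀ (ν : Measure Y) [IsFiniteMeasure ν], ν.real Set.univ ≤ 1 →
        dist (∫ y, F y ∂ν) (∫ y, P y ∂ν) ≤ ε / 3 := by
      intro ν _ hν
      rw [dist_eq_norm, ← integral_sub (hint ν F) (hint ν P)]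
      refine (norm_integral_le_of_norm_le_const (C := ε / 3) (.of_forall fun y => ?_)).trans ?_
      · rw [← dist_eq_norm]
        exact (ContinuousMap.dist_apply_le_dist y).trans hd.le
      · exact mul_le_of_le_one_right (by positivity) hν
    filter_upwards [(Metric.tendsto_nhds.1 (hV P hP)) (ε / 3) (by positivity)] with N hN
    have h1 := hb (μs N) (hμs N)
    have h2 := hb μ hμ
    rw [dist_comm] at h2
    linarith [dist_triangle4 (∫ y, F y ∂μs N) (∫ y, P y ∂μs N) (∫ y, P y ∂μ) (∫ y, F y ∂μ)]
  have := hC ⟨fun y => (F y : ℂ), Complex.continuous_ofReal.comp hF⟩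
  simp only [ContinuousMap.coe_mk, integral_complex_ofReal] at this
  exact (Complex.continuous_re.tendsto _).comp this

end Characters

/-! ### Haar measure on cosets of a closed subgroup -/

section CosetMeasure

lemma measurable_coe_add {G : Type*} [AddCommGroup G] [TopologicalSpace G]
    [IsTopologicalAddGroup G] [MeasurableSpace G] [BorelSpace G] (H : AddSubgroup G) (t : G) : Measurable fun x : H => (x : G) + t :=
  (continuous_subtype_val.add continuous_const).measurable

variable {G : Type*} [AddCommGroup G] [TopologicalSpace G] [IsTopologicalAddGroup G]
  [CompactSpace G] [MeasurableSpace G] [BorelSpace G]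

instance isProbabilityMeasure_cosetHaar (H : AddSubgroup G) (hH : IsClosed (H : Set G)) (t : G) :
    IsProbabilityMeasure (cosetHaar H hH t) := by
  have : CompactSpace H := isCompact_iff_compactSpace.mp hH.isCompact
  have : IsProbabilityMeasure
      (Measure.addHaarMeasure (⊤ : TopologicalSpace.PositiveCompacts H)) :=
    ⟨by simpa using Measure.addHaarMeasure_self (K₀ := (⊤ : TopologicalSpace.PositiveCompacts H))⟩
  exact Measure.isProbabilityMeasure_map (measurable_coe_add H t).aemeasurable

lemma map_add_cosetHaar (H : AddSubgroup G) (hH : IsClosed (H : Set G)) (t : G) {w : G}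
    (hw : w ∈ H) : (cosetHaar H hH t).map (w + ·) = cosetHaar H hH t := by
  have : CompactSpace H := isCompact_iff_compactSpace.mp hH.isCompact
  have h1 := map_add_left_eq_self
    (Measure.addHaarMeasure (⊤ : TopologicalSpace.PositiveCompacts H)) ⟨w, hw⟩
  unfold cosetHaar
  conv_rhs => rw [← h1]
  rw [Measure.map_map (continuous_const_add w).measurable (measurable_coe_add H t),
    Measure.map_map (measurable_coe_add H t) (continuous_const_add _).measurable]
  congr 1
  ext x
  simp [add_assoc]

/-- The measure on a coset is invariant only under translations by `H`, so the orthogonality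
argument needs `ψ` to be nontrivial on `H` itself. -/
lemma integral_expCircle_cosetHaar (H : AddSubgroup G) (hH : IsClosed (H : Set G)) (t : G)
    {ψ : G →+ UnitAddCircle} (hψ : ∃ w ∈ H, ψ w ≠ 0) :
    ∫ w, expCircle (ψ w) ∂(cosetHaar H hH t) = 0 := by
  obtain ⟨a, haH, ha⟩ := hψ
  have h1 : ∫ w, expCircle (ψ (a + w)) ∂(cosetHaar H hH t) =
      ∫ w, expCircle (ψ w) ∂(cosetHaar H hH t) := by
    conv_rhs => rw [← map_add_cosetHaar H hH t haH]
    exact ((Homeomorph.addLeft a).isClosedEmbedding.measurableEmbedding.integral_map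
      (fun w => expCircle (ψ w))).symm
  simp only [map_add, expCircle_add, integral_const_mul] at h1
  have h2 : expCircle (ψ a) ≠ 1 := fun h2 => ha (expCircle_eq_one.1 h2)
  have h3 : (expCircle (ψ a) - 1) * ∫ w, expCircle (ψ w) ∂(cosetHaar H hH t) = 0 := by
    rw [sub_mul, h1, one_mul, sub_self]
  exact (mul_eq_zero.1 h3).resolve_left (sub_ne_zero.2 h2)

lemma integral_expCircle_cosetHaar_of_trivial (H : AddSubgroup G) (hH : IsClosed (H : Set G))
    (t : G) {ψ : G →+ UnitAddCircle} (hc : Continuous ψ) (hψ : ∀ w ∈ H, ψ w = 0) :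
    ∫ w, expCircle (ψ w) ∂(cosetHaar H hH t) = expCircle (ψ t) := by
  have : CompactSpace H := isCompact_iff_compactSpace.mp hH.isCompact
  have : IsProbabilityMeasure
      (Measure.addHaarMeasure (⊤ : TopologicalSpace.PositiveCompacts H)) :=
    ⟨by simpa using Measure.addHaarMeasure_self (K₀ := (⊤ : TopologicalSpace.PositiveCompacts H))⟩
  unfold cosetHaar
  rw [integral_map (f := fun w => expCircle (ψ w)) (measurable_coe_add H t).aemeasurable
    (continuous_expCircle.comp hc).measurable.aestronglyMeasurable]
  simp only [map_add]
  have h : ∀ x : H, ψ (x : G) = 0 := fun x => hψ x x.2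
  simp [h]

end CosetMeasure

/-! ### The measure of an affine joining and its marginal on `W` -/

section AffineJoiningMeasure

variable {Z W : Type*} [AddCommGroup Z] [TopologicalSpace Z] [IsTopologicalAddGroup Z]
  [CompactSpace Z] [AddCommGroup W] [TopologicalSpace W] [IsTopologicalAddGroup W] [CompactSpace W]

/-- The measure `m_Γ` of an affine joining. -/
noncomputable def AffineJoining.measure [MeasurableSpace (Z × W)] [BorelSpace (Z × W)]
    (Γ : AffineJoining Z W) : Measure (Z × W) :=
  ∑ j, ENNReal.ofReal (Γ.c j) • cosetHaar Γ.base Γ.isJoining.isClosed (Γ.shift j)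

instance [MeasurableSpace (Z × W)] [BorelSpace (Z × W)] (Γ : AffineJoining Z W) :
    IsProbabilityMeasure Γ.measure := ⟨by
  simp only [AffineJoining.measure, Measure.coe_finsetSum, Finset.sum_apply, Measure.smul_apply,
    measure_univ, smul_eq_mul, mul_one]
  rw [← ENNReal.ofReal_sum_of_nonneg fun j _ => (Γ.c_mem j).1, Γ.c_sum, ENNReal.ofReal_one]⟩

lemma AffineJoining.integral_measure [MeasurableSpace (Z × W)] [BorelSpace (Z × W)]
    (Γ : AffineJoining Z W) {E : Type*} [NormedAddCommGroup E] [NormedSpace ℝ E] {F : Z × W → E}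
    (hF : ∀ j, Integrable F (cosetHaar Γ.base Γ.isJoining.isClosed (Γ.shift j))) :
    ∫ w, F w ∂Γ.measure =
      ∑ j, Γ.c j • ∫ w, F w ∂(cosetHaar Γ.base Γ.isJoining.isClosed (Γ.shift j)) := by
  rw [AffineJoining.measure, integral_finsetSum_measure]
  · simp only [integral_smul_measure, ENNReal.toReal_ofReal (Γ.c_mem _).1]
  · intro j _
    exact (hF j).smul_measure ENNReal.ofReal_ne_top

lemma AffineJoining.integral_eq [MeasurableSpace (Z × W)] [BorelSpace (Z × W)]
    (Γ : AffineJoining Z W) {F : Z × W → ℝ}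
    (hF : ∀ j, Integrable F (cosetHaar Γ.base Γ.isJoining.isClosed (Γ.shift j))) :
    Γ.integral F = ∫ w, F w ∂Γ.measure := by
  rw [Γ.integral_measure hF]
  rfl

/-- The cosets of a joining of `Z` with `W` project to Haar measure on `W`. -/
lemma AffineJoining.map_snd_cosetHaar [MeasurableSpace Z] [BorelSpace Z] [MeasurableSpace W]
    [BorelSpace W] [SecondCountableTopology W] [BorelSpace (Z × W)]
    (μ : Measure W) [μ.IsAddHaarMeasure] [IsProbabilityMeasure μ] (Γ : AffineJoining Z W) :
    ∀ j, (cosetHaar Γ.base Γ.isJoining.isClosed (Γ.shift j)).map Prod.snd = μ := by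
  intro j
  set κ := cosetHaar Γ.base Γ.isJoining.isClosed (Γ.shift j)
  have : IsProbabilityMeasure (κ.map Prod.snd) :=
    Measure.isProbabilityMeasure_map measurable_snd.aemeasurable
  have : (κ.map Prod.snd).IsAddLeftInvariant := ⟨fun b => by
    obtain ⟨w, hw, rfl⟩ := Γ.isJoining.snd_surj b
    rw [Measure.map_map (continuous_const_add _).measurable measurable_snd]
    have hκ : κ = κ.map (w + ·) :=
      (map_add_cosetHaar Γ.base Γ.isJoining.isClosed (Γ.shift j) hw).symm
    conv_rhs => rw [hκ]
    rw [Measure.map_map measurable_snd (continuous_const_add _).measurable]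
    rfl⟩
  -- The projection is translation invariant because `Γ.base` surjects onto `W`; uniqueness of Haar
  -- measure then leaves a scalar, which total mass fixes at 1.
  have h := Measure.isAddLeftInvariant_eq_smul (κ.map Prod.snd) μ
  have h1 := congrArg (fun ν : Measure W => ν Set.univ) h
  simp only [measure_univ, Measure.smul_apply] at h1
  rw [h]
  set s := Measure.addHaarScalarFactor (κ.map Prod.snd) μ
  have : s = 1 := by
    have h2 : (s : ENNReal) = 1 := by rw [h1]; simp [ENNReal.smul_def]
    exact_mod_cast h2
  rw [this, one_smul]

end AffineJoiningMeasure

/-! ### Construction of the joining and equidistribution of squares along it -/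

section Construction

/-- The torsion of a finitely generated subgroup has bounded exponent. -/
lemma exists_torsion_exponent {A : Type*} [AddCommGroup A] {s : Set A} (hs : s.Finite) :
    ∃ q : ℕ, 0 < q ∧ ∀ x ∈ AddSubgroup.closure s, ∀ n : ℕ, 0 < n → n • x = 0 → q • x = 0 := by
  let S := Submodule.span ℤ s
  have : IsNoetherian ℤ S := isNoetherian_span_of_finite ℤ hs
  -- The torsion of a finitely generated abelian group is finite, so its order serves as the
  -- exponent.
  let T := Submodule.torsion ℤ S
  have : Finite T := Module.finite_of_fg_torsion T (Submodule.torsion_isTorsion)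
  refine ⟨Nat.card T, Nat.card_pos, fun x hx n hn hnx => ?_⟩
  have hxS : x ∈ S := by
    have : x ∈ (Submodule.span ℤ s).toAddSubgroup := by rwa [Submodule.span_int_eq_addSubgroupClosure]
    exact this
  have hxT : (⟨x, hxS⟩ : S) ∈ T := by
    rw [Submodule.mem_torsion_iff]
    refine ⟨⟨(n : ℤ), mem_nonZeroDivisors_of_ne_zero (by exact_mod_cast hn.ne')⟩, ?_⟩
    ext
    simpa using hnx
  have := card_nsmul_eq_zero' (x := (⟨⟨x, hxS⟩, hxT⟩ : T))
  simpa using congrArg (fun t : T => ((t : S) : A)) this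

variable {d r : ℕ}

/-- The coordinate characters of `𝕋ᵈ × 𝕋ʳ`. -/
def coordChar (d r : ℕ) : Fin d ⊕ Fin r → (Torus d × Torus r →+ UnitAddCircle)
  | .inl i => (Pi.evalAddMonoidHom _ i).comp (AddMonoidHom.fst _ _)
  | .inr i => (Pi.evalAddMonoidHom _ i).comp (AddMonoidHom.snd _ _)

lemma continuous_coordChar (i : Fin d ⊕ Fin r) : Continuous (coordChar d r i) := by
  rcases i with i | i
  · exact (continuous_apply i).comp continuous_fst
  · exact (continuous_apply i).comp continuous_snd

instance : IsProbabilityMeasure (volume : Measure UnitAddCircle) := ⟨UnitAddCircle.measure_univ⟩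

instance (d r : ℕ) :
    (((volume : Measure (Torus d)).prod (volume : Measure (Torus r)))).IsAddLeftInvariant :=
  Measure.prod.instIsAddLeftInvariant

instance (d r : ℕ) : MeasurableAdd (Torus d × Torus r) := ⟨fun c => (continuous_const_add c).measurable,
    fun _ => (continuous_id.add continuous_const).measurable⟩

/-- Continuous characters of `𝕋ᵈ × 𝕋ʳ` are integral combinations of coordinates. -/
lemma mem_closure_coordChar (ω : Torus d × Torus r →+ UnitAddCircle) (hω : Continuous ω) :
    ω ∈ AddSubgroup.closure (Set.range (coordChar d r)) := by
  refine mem_of_separating ((volume : Measure (Torus d)).prod (volume : Measure (Torus r))) _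
    (fun ψ hψ => ?_) (fun x y hxy => ?_) ω hω
  · induction hψ using AddSubgroup.closure_induction with
    | mem ψ h =>
      obtain ⟨i, rfl⟩ := h
      exact continuous_coordChar i
    | zero => exact continuous_const
    | add ψ χ _ _ h1 h2 => exact h1.add h2
    | neg ψ _ h => exact h.neg
  · by_contra! h
    apply hxy
    ext i
    · exact h _ (AddSubgroup.subset_closure ⟨.inl i, rfl⟩)
    · exact h _ (AddSubgroup.subset_closure ⟨.inr i, rfl⟩)

/-- The values at `γ` of the continuous characters of `𝕋ᵈ × 𝕋ʳ` have bounded torsion. -/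
lemma exists_torsion_exponent_characters (γ : Torus d × Torus r) :
    ∃ q : ℕ, 0 < q ∧ ∀ ω : Torus d × Torus r →+ UnitAddCircle, Continuous ω →
      ∀ n : ℕ, 0 < n → n • ω γ = 0 → q • ω γ = 0 := by
  obtain ⟨q, hq, h⟩ := exists_torsion_exponent
    (Set.finite_range fun i => coordChar d r i γ)
  refine ⟨q, hq, fun ω hω n hn hz => h _ ?_ n hn hz⟩
  have hmem := mem_closure_coordChar ω hω
  clear hz hω
  induction hmem using AddSubgroup.closure_induction with
  | mem ψ h =>
    obtain ⟨i, rfl⟩ := h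
    exact AddSubgroup.subset_closure ⟨i, rfl⟩
  | zero => exact zero_mem _
  | add ψ χ _ _ h1 h2 => exact add_mem h1 h2
  | neg ψ _ h => exact neg_mem h

/-- Multiplication by `q` is a continuous surjection of the torus, so it carries a dense orbit to a
dense orbit. This keeps the closure of the multiples of `q • (α, β)` a joining. -/
lemma Generates.nsmul {α : Torus d} (hα : Generates α) {q : ℕ} (hq : 0 < q) :
    Generates (q • α) := by
  have h1 : DenseRange fun n : ℤ => n • α := hα
  have hs : Function.Surjective fun x : Torus d => q • x := fun x => exists_nsmul_eq_torus hq x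
  have h2 := hs.denseRange.comp h1 (continuous_const_smul q)
  have : (fun n : ℤ => n • q • α) = (fun x : Torus d => q • x) ∘ fun n : ℤ => n • α := by
    ext1 n
    exact smul_comm _ _ _
  rw [Generates, this]
  exact h2

/-- The image of the compact closure is closed and contains the dense orbit of `p g`. -/
lemma surjOn_closure_zmultiples {Z G : Type*} [AddCommGroup G] [TopologicalSpace G]
    [IsTopologicalAddGroup G] [CompactSpace G] [AddCommGroup Z] [TopologicalSpace Z] [T2Space Z]
    {g : G} (p : G →+ Z) (hp : Continuous p) (hg : Generates (p g)) (z : Z) :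
    ∃ w ∈ (AddSubgroup.zmultiples g).topologicalClosure, p w = z := by
  have hcl : IsClosed (p '' ((AddSubgroup.zmultiples g).topologicalClosure : Set G)) :=
    ((AddSubgroup.isClosed_topologicalClosure _).isCompact.image hp).isClosed
  have hsub : Set.range (fun n : ℤ => n • p g) ⊆
      p '' ((AddSubgroup.zmultiples g).topologicalClosure : Set G) := by
    rintro _ ⟨n, rfl⟩
    exact ⟨n • g, AddSubgroup.le_topologicalClosure _ (AddSubgroup.zsmul_mem_zmultiples g n),
      by simp⟩
  exact hcl.closure_subset_iff.2 hsub (hg z)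

lemma isJoining_closure_zmultiples {Z W : Type*} [AddCommGroup Z] [TopologicalSpace Z]
    [IsTopologicalAddGroup Z] [CompactSpace Z] [T2Space Z] [AddCommGroup W] [TopologicalSpace W]
    [IsTopologicalAddGroup W] [CompactSpace W] [T2Space W] {g : Z × W} (h1 : Generates g.1)
    (h2 : Generates g.2) : IsJoining (AddSubgroup.zmultiples g).topologicalClosure where
  isClosed := AddSubgroup.isClosed_topologicalClosure _
  fst_surj := surjOn_closure_zmultiples (AddMonoidHom.fst Z W) continuous_fst h1
  snd_surj := surjOn_closure_zmultiples (AddMonoidHom.snd Z W) continuous_snd h2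

/-- The affine joining along which `n² (α, β)` equidistributes, where `q` annihilates the torsion
of the characters at `(α, β)`: the base is the closure of the multiples of `q (α, β)`. -/
noncomputable def squaresJoining (α : Torus d) (β : Torus r) (hα : Generates α) (hβ : Generates β)
    (q : ℕ) (hq : 0 < q) : AffineJoining (Torus d) (Torus r) where
  base := (AddSubgroup.zmultiples (q • ((α, β) : Torus d × Torus r))).topologicalClosure
  isJoining := isJoining_closure_zmultiples (hα.nsmul hq) (hβ.nsmul hq)
  k := q
  -- If `n ≡ j` mod `q`, then `n² ≡ j²` mod `q`, so `n² (α, β)` lies in the coset of `j² (α, β)`.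
  -- Residues occur equally often, whence the weights `1 / q`; distinct `j` may give the same coset.
  shift j := (j : ℕ) ^ 2 • (α, β)
  c _ := 1 / q
  c_mem _ := ⟨by positivity, by
    rw [div_le_one (by exact_mod_cast hq)]
    exact_mod_cast hq⟩
  c_sum := by
    have : (q : ℝ) ≠ 0 := by exact_mod_cast hq.ne'
    simp [this]

/-- A character with `q • ω (α, β) = 0` is trivial on the base, and along the squares it depends
only on `n` mod `q`, so both sides are the mean over residues. Otherwise `htor` makes `ω (α, β)` of
infinite order: the left side vanishes by Weyl and the right side because `ω` is nontrivial on the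
base. -/
theorem tendsto_cesaro_squaresJoining {α : Torus d} {β : Torus r} (hα : Generates α)
    (hβ : Generates β) {q : ℕ} (hq : 0 < q)
    (htor : ∀ ω : Torus d × Torus r →+ UnitAddCircle, Continuous ω →
      ∀ n : ℕ, 0 < n → n • ω (α, β) = 0 → q • ω (α, β) = 0)
    (ω : Torus d × Torus r →+ UnitAddCircle) (hω : Continuous ω) :
    Tendsto (cesaro fun n => expCircle (n ^ 2 • ω (α, β))) atTop
      (𝓝 (∫ w, expCircle (ω w) ∂(squaresJoining α β hα hβ q hq).measure)) := by
  set Γ := squaresJoining α β hα hβ q hq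
  have hint : ∀ j, Integrable (fun w => expCircle (ω w))
      (cosetHaar Γ.base Γ.isJoining.isClosed (Γ.shift j)) := fun j =>
    Continuous.integrable_of_hasCompactSupport (continuous_expCircle.comp hω)
      (HasCompactSupport.of_compactSpace _)
  rw [Γ.integral_measure hint]
  by_cases h : q • ω (α, β) = 0
  · have htriv : ∀ w ∈ Γ.base, ω w = 0 := by
      have hcl : IsClosed {w | ω w = 0} := isClosed_eq hω continuous_const
      have hsub : (AddSubgroup.zmultiples (q • ((α, β) : Torus d × Torus r)) : Set _) ⊆
          {w | ω w = 0} := by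
        rintro _ ⟨n, rfl⟩
        simp only [Set.mem_ofPred_eq, map_zsmul, map_nsmul, h, smul_zero]
      exact fun w hw => hcl.closure_subset_iff.2 hsub hw
    have hper := tendsto_cesaro_of_periodic (u := fun n => expCircle (n ^ 2 • ω (α, β))) hq
      fun n => by
        rw [show (n + q) ^ 2 = n ^ 2 + (2 * n + q) * q by ring, add_smul, mul_smul, h, smul_zero,
          add_zero]
    convert hper using 2
    simp only [integral_expCircle_cosetHaar_of_trivial _ _ _ hω htriv]
    rw [← Fin.sum_univ_eq_sum_range (fun j => expCircle (j ^ 2 • ω (α, β))), Finset.mul_sum]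
    refine Finset.sum_congr rfl fun j _ => ?_
    have hc : Γ.c j = 1 / q := rfl
    have hs : Γ.shift j = (j : ℕ) ^ 2 • (α, β) := rfl
    rw [hc, hs, map_nsmul, Complex.real_smul]
    push_cast
    rfl
  · have hne : ∃ w ∈ Γ.base, ω w ≠ 0 :=
      ⟨q • (α, β), AddSubgroup.le_topologicalClosure _ (AddSubgroup.mem_zmultiples _), by
        rwa [map_nsmul]⟩
    simp only [integral_expCircle_cosetHaar _ _ _ hne, smul_zero, Finset.sum_const_zero]
    have := tendsto_cesaro_quadratic (θ := ω (α, β)) (fun n hn h0 => h (htor ω hω n hn h0)) 0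
    simpa using this

end Construction

/-! ### Iterates and invariant measure of the skew product -/

section SkewProduct

variable {Z : Type*} [AddCommGroup Z]

/-- The skew product `(x, y) ↦ (x + 2α, y + x)`. -/
def skewMap (α : Z) : Z × Z → Z × Z := fun p => (p.1 + 2 • α, p.2 + p.1)

lemma skewMap_iterate (α : Z) (n : ℕ) (p : Z × Z) :
    (skewMap α)^[n] p = (p.1 + (2 * n) • α, p.2 + n • p.1 + (n ^ 2 • α - n • α)) := by
  induction n with
  | zero => simp
  | succ n ih =>
    rw [Function.iterate_succ_apply', ih, skewMap]
    simp only [← natCast_zsmul]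
    push_cast
    ext
    · simp only; module
    · simp only; module

variable [TopologicalSpace Z] [IsTopologicalAddGroup Z] [SecondCountableTopology Z]
  [MeasurableSpace Z] [BorelSpace Z]

lemma continuous_skewMap (α : Z) : Continuous (skewMap α) := by
  unfold skewMap
  fun_prop

lemma measurePreserving_skewMap (m : Measure Z) [m.IsAddLeftInvariant] [SFinite m] (α : Z) :
    MeasurePreserving (skewMap α) (m.prod m) (m.prod m) := by
  refine MeasurePreserving.skew_product (f := fun x => x + 2 • α) (g := fun x y => y + x) ?_ ?_ ?_
  · simpa only [add_comm] using measurePreserving_add_left m (2 • α)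
  · exact (continuous_snd.add continuous_fst).measurable
  · refine .of_forall fun x => ?_
    simpa only [add_comm] using map_add_left_eq_self m x

end SkewProduct

/-! ### Orbits as perturbed arithmetic progressions -/

section Progressions

variable {Z W : Type*} [AddCommGroup Z] [AddCommGroup W]

/-- The point `(p, Sⁿ p, S²ⁿ p, n² β)`. -/
def orbitPoint (α : Z) (β : W) (n : ℕ) (p : Z × Z) : (Z × Z) × (Z × Z) × (Z × Z) × W :=
  (p, (skewMap α)^[n] p, (skewMap α)^[2 * n] p, n ^ 2 • β)

/-- The point `((x, y), (x + s, y + t), (x + 2s, y + 2t + 2w₁), w₂)`, as a function of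
`(y, x, t, s, w)`. -/
def progressionPoint (v : Z × Z × Z × Z × (Z × W)) : (Z × Z) × (Z × Z) × (Z × Z) × W :=
  ((v.2.1, v.1), (v.2.1 + v.2.2.2.1, v.1 + v.2.2.1),
    (v.2.1 + 2 • v.2.2.2.1, v.1 + 2 • v.2.2.1 + 2 • v.2.2.2.2.1), v.2.2.2.2.2)

/-- In the second difference S²ⁿp - 2Sⁿp + p the linear terms cancel: its second coordinate is (4n²
- 2n)α - 2(n² - n)α = 2n²α. This is the term `2 • w.1` with `w = n ^ 2 • (α, β)`. -/
lemma orbitPoint_eq_progressionPoint (α : Z) (β : W) (n : ℕ) (p : Z × Z) :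
    orbitPoint α β n p =
      progressionPoint (p.2, p.1, n • p.1 + (n ^ 2 • α - n • α), (2 * n) • α, n ^ 2 • (α, β)) := by
  obtain ⟨x, y⟩ := p
  simp only [orbitPoint, progressionPoint, skewMap_iterate, Prod.mk.injEq, Prod.smul_mk,
    ← natCast_zsmul]
  push_cast
  refine ⟨trivial, ⟨trivial, ?_⟩, ⟨?_, ?_⟩, trivial⟩ <;> module

variable {A : Type*} [AddCommGroup A]

/-- The restrictions of a homomorphism to the five one-parameter families in the parametrization of
progressions. -/
lemma exists_decomposition (ψ : (Z × Z) × (Z × Z) × (Z × Z) × W →+ A) :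
    ∃ (a b e q : Z →+ A) (ω : Z × W →+ A),
      (∀ x, a x = ψ ((x, 0), (x, 0), (x, 0), 0)) ∧
      (∀ t, b t = ψ ((0, 0), (0, t), (0, 2 • t), 0)) ∧
      (∀ s, e s = ψ ((0, 0), (s, 0), (2 • s, 0), 0)) ∧
      (∀ y, q y = ψ ((0, y), (0, y), (0, y), 0)) ∧
      (∀ w, ω w = ψ ((0, 0), (0, 0), (0, 2 • w.1), w.2)) ∧
      ∀ y x t s w, ψ (progressionPoint (y, x, t, s, w)) = q y + (a x + (b t + (e s + ω w))) := by
  refine ⟨AddMonoidHom.mk' (fun x => ψ ((x, 0), (x, 0), (x, 0), 0)) ?_,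
    AddMonoidHom.mk' (fun t => ψ ((0, 0), (0, t), (0, 2 • t), 0)) ?_,
    AddMonoidHom.mk' (fun s => ψ ((0, 0), (s, 0), (2 • s, 0), 0)) ?_,
    AddMonoidHom.mk' (fun y => ψ ((0, y), (0, y), (0, y), 0)) ?_,
    AddMonoidHom.mk' (fun w => ψ ((0, 0), (0, 0), (0, 2 • w.1), w.2)) ?_,
    fun _ => rfl, fun _ => rfl, fun _ => rfl, fun _ => rfl, fun _ => rfl, ?_⟩
  · intro u v; simp [← map_add]
  · intro u v; simp [← map_add]
  · intro u v; simp [← map_add]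
  · intro u v; simp [← map_add]
  · intro u v; simp [← map_add]
  · intro y x t s w
    simp only [AddMonoidHom.mk'_apply, ← map_add, progressionPoint, Prod.mk_add_mk, add_zero,
      zero_add]
    simp only [add_assoc]

end Progressions

section Cesaro

lemma tendsto_cesaro_of_eventually_zero {u : ℕ → ℂ} (h : ∀ᶠ n in atTop, u n = 0) :
    Tendsto (cesaro u) atTop (𝓝 0) := by
  obtain ⟨n₀, hn₀⟩ := eventually_atTop.1 h
  have hs : Summable fun n => ‖u (n + 1)‖ :=
    summable_of_ne_finset_zero (s := Finset.range n₀) fun n hn => by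
      rw [hn₀ (n + 1) (by simp at hn; omega), norm_zero]
  exact tendsto_cesaro_zero_of_bounded fun N =>
    (norm_sum_le _ _).trans (hs.sum_le_tsum _ fun _ _ => norm_nonneg _)

end Cesaro

/-! ### Convergence of the orbit laws on characters -/

section Equidistribution

variable {Z W : Type*} [AddCommGroup Z] [TopologicalSpace Z] [IsTopologicalAddGroup Z]
  [SecondCountableTopology Z] [MeasurableSpace Z] [BorelSpace Z] [AddCommGroup W]
  [TopologicalSpace W] [IsTopologicalAddGroup W]
  [SecondCountableTopology W] [MeasurableSpace W] [BorelSpace W]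

lemma continuous_orbitPoint (α : Z) (β : W) (n : ℕ) : Continuous (orbitPoint α β n) := by
  unfold orbitPoint
  have h := continuous_skewMap α
  exact continuous_id.prodMk ((h.iterate n).prodMk ((h.iterate (2 * n)).prodMk continuous_const))

lemma continuous_progressionPoint :
    Continuous (progressionPoint : Z × Z × Z × Z × (Z × W) → _) := by
  unfold progressionPoint
  fun_prop

/-- The uniform average of the laws of `(p, Sⁿ p, S²ⁿ p, n² β)`, `1 ≤ n ≤ N`. -/
noncomputable def orbitMeasure (m : Measure Z) (α : Z) (β : W) (N : ℕ) :
    Measure ((Z × Z) × (Z × Z) × (Z × Z) × W) :=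
  (N : ENNReal)⁻¹ • ∑ n ∈ Finset.Icc 1 N, (m.prod m).map (orbitPoint α β n)

/-- The law of `((x, y), (x + s, y + t), (x + 2s, y + 2t + 2w₁), w₂)`. -/
noncomputable def progressionMeasure (m : Measure Z) (κ : Measure (Z × W)) :
    Measure ((Z × Z) × (Z × Z) × (Z × Z) × W) :=
  (m.prod (m.prod (m.prod (m.prod κ)))).map progressionPoint

variable (m : Measure Z) [m.IsAddLeftInvariant] [IsProbabilityMeasure m]

/-- Only an inequality holds in general: at `N = 0` the measure is `⊤` times an empty sum, which is
zero. -/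
lemma orbitMeasure_univ_le (α : Z) (β : W) (N : ℕ) :
    orbitMeasure m α β N Set.univ ≤ 1 := by
  have : ∀ n, IsProbabilityMeasure ((m.prod m).map (orbitPoint α β n)) := fun n =>
    Measure.isProbabilityMeasure_map (continuous_orbitPoint α β n).measurable.aemeasurable
  simp only [orbitMeasure, Measure.smul_apply, Measure.coe_finsetSum, Finset.sum_apply,
    measure_univ, Finset.sum_const, Nat.card_Icc, Nat.add_sub_cancel, smul_eq_mul, nsmul_eq_mul,
    mul_one]
  exact ENNReal.inv_mul_le_one _

instance (α : Z) (β : W) (N : ℕ) : IsFiniteMeasure (orbitMeasure m α β N) :=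
  ⟨(orbitMeasure_univ_le m α β N).trans_lt ENNReal.one_lt_top⟩

instance (κ : Measure (Z × W)) [IsProbabilityMeasure κ] :
    IsProbabilityMeasure (progressionMeasure m κ) :=
  Measure.isProbabilityMeasure_map continuous_progressionPoint.measurable.aemeasurable

lemma integral_orbitMeasure {E : Type*} [NormedAddCommGroup E] [NormedSpace ℝ E]
    [SecondCountableTopology E] [MeasurableSpace E] [BorelSpace E] (α : Z) (β : W)
    {F : (Z × Z) × (Z × Z) × (Z × Z) × W → E} (hF : Measurable F) {C : ℝ} (hC : ∀ v, ‖F v‖ ≤ C)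
    (N : ℕ) :
    ∫ v, F v ∂(orbitMeasure m α β N) =
      (1 / (N : ℝ)) • ∑ n ∈ Finset.Icc 1 N, ∫ p, F (orbitPoint α β n p) ∂(m.prod m) := by
  have : ∀ n, IsProbabilityMeasure ((m.prod m).map (orbitPoint α β n)) := fun n =>
    Measure.isProbabilityMeasure_map (continuous_orbitPoint α β n).measurable.aemeasurable
  rw [orbitMeasure, integral_smul_measure, integral_finsetSum_measure]
  · simp only [ENNReal.toReal_inv, ENNReal.toReal_natCast, one_div]
    congr 1
    refine Finset.sum_congr rfl fun n _ => ?_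
    rw [integral_map (continuous_orbitPoint α β n).measurable.aemeasurable
      hF.aestronglyMeasurable]
  · exact fun n _ => Integrable.of_bound hF.aestronglyMeasurable C (.of_forall hC)

variable {m} in
/-- The averaged laws of `(p, Sⁿ p, S²ⁿ p, n² β)` converge on characters. -/
lemma tendsto_integral_character_orbitMeasure {α : Z} {β : W} {κ : Measure (Z × W)} [SFinite κ]
    (hα : ∀ ψ : Z →+ UnitAddCircle, Continuous ψ → ψ ≠ 0 → ∀ n : ℕ, 0 < n → n • ψ α ≠ 0)
    (hdiv : ∀ ψ : Z →+ UnitAddCircle, ∀ n : ℕ, 0 < n → n • ψ = 0 → ψ = 0)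
    (hκ : ∀ ω : Z × W →+ UnitAddCircle, Continuous ω →
      Tendsto (cesaro fun n => expCircle (n ^ 2 • ω (α, β))) atTop (𝓝 (∫ w, expCircle (ω w) ∂κ)))
    (ψ : (Z × Z) × (Z × Z) × (Z × Z) × W →+ UnitAddCircle) (hψ : Continuous ψ) :
    Tendsto (fun N => ∫ v, expCircle (ψ v) ∂(orbitMeasure m α β N)) atTop
      (𝓝 (∫ v, expCircle (ψ v) ∂(progressionMeasure m κ))) := by
  classical
  obtain ⟨a, b, e, q, ω, ha, hb, he, hq, hω, hdec⟩ := exists_decomposition ψ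
  have hec : Continuous e := by
    have : (e : Z → UnitAddCircle) = fun s => ψ ((0, 0), (s, 0), (2 • s, 0), 0) := funext he
    rw [this]; fun_prop
  have hωc : Continuous ω := by
    have : (ω : Z × W → UnitAddCircle) = fun w => ψ ((0, 0), (0, 0), (0, 2 • w.1), w.2) :=
      funext hω
    rw [this]; fun_prop
  have hmeas : Measurable fun v => expCircle (ψ v) := (continuous_expCircle.comp hψ).measurable
  have hR : ∫ v, expCircle (ψ v) ∂(progressionMeasure m κ) =
      (if q = 0 then 1 else 0) * ((if a = 0 then 1 else 0) * ((if b = 0 then 1 else 0) *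
        ((if e = 0 then 1 else 0) * ∫ w, expCircle (ω w) ∂κ))) := by
    rw [progressionMeasure, integral_map (f := fun v => expCircle (ψ v))
      continuous_progressionPoint.measurable.aemeasurable hmeas.aestronglyMeasurable]
    have : ∀ v : Z × Z × Z × Z × (Z × W), expCircle (ψ (progressionPoint v)) =
        expCircle (q v.1) * (expCircle (a v.2.1) * (expCircle (b v.2.2.1) *
          (expCircle (e v.2.2.2.1) * expCircle (ω v.2.2.2.2)))) := fun v => by
      simp only [← expCircle_add]
      rw [← hdec]
    simp_rw [this]
    rw [integral_prod_mul (f := fun y => expCircle (q y)) (g := fun v : Z × Z × Z × (Z × W) =>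
        expCircle (a v.1) * (expCircle (b v.2.1) *
          (expCircle (e v.2.2.1) * expCircle (ω v.2.2.2)))),
      integral_prod_mul (f := fun y => expCircle (a y)) (g := fun v : Z × Z × (Z × W) =>
        (expCircle (b v.1) * (expCircle (e v.2.1) * expCircle (ω v.2.2)))),
      integral_prod_mul (f := fun y => expCircle (b y)) (g := fun v : Z × (Z × W) =>
        ((expCircle (e v.1) * expCircle (ω v.2)))),
      integral_prod_mul (f := fun y => expCircle (e y)) (g := fun v : Z × W => expCircle (ω v))]
    simp only [integral_expCircle_eq_ite]
  -- Since `t = n x + (n² - n) α` involves `x`, the character seen by `x` is `a + n • b`; the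
  -- remaining phase does not depend on `p` and is quadratic in `n`.
  have hL : ∀ n : ℕ, ∫ p, expCircle (ψ (orbitPoint α β n p)) ∂(m.prod m) =
      (if q = 0 then 1 else 0) * ((if a + n • b = 0 then 1 else 0) *
        expCircle (n • (2 • e α - b α) + n ^ 2 • (b α + ω (α, β)))) := by
    intro n
    have : ∀ p : Z × Z, expCircle (ψ (orbitPoint α β n p)) =
        expCircle ((a + n • b) p.1) * expCircle (q p.2) *
          expCircle (n • (2 • e α - b α) + n ^ 2 • (b α + ω (α, β))) := fun p => by
      rw [orbitPoint_eq_progressionPoint, hdec]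
      simp only [← expCircle_add, map_add, map_sub, map_nsmul, AddMonoidHom.add_apply,
        AddMonoidHom.smul_apply]
      congr 1
      simp only [← natCast_zsmul]
      push_cast
      module
    simp_rw [this]
    rw [integral_mul_const,
      integral_prod_mul (f := fun x => expCircle ((a + n • b) x)) (g := fun y => expCircle (q y))]
    simp only [integral_expCircle_eq_ite]
    ring
  have hces : (fun N => ∫ v, expCircle (ψ v) ∂(orbitMeasure m α β N)) = cesaro fun n =>
      (if q = 0 then 1 else 0) * ((if a + n • b = 0 then 1 else 0) *
        expCircle (n • (2 • e α - b α) + n ^ 2 • (b α + ω (α, β)))) := by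
    ext N
    rw [integral_orbitMeasure m α β hmeas (C := 1) (fun v => (norm_expCircle _).le), cesaro]
    simp_rw [hL, Complex.real_smul]
    push_cast
    rfl
  rw [hces, hR]
  by_cases hq0 : q = 0
  swap
  · simp only [hq0, if_false, zero_mul]
    exact tendsto_cesaro_of_eventually_zero (.of_forall fun _ => rfl)
  simp only [hq0, if_true, one_mul]
  by_cases hb0 : b = 0
  swap
  · simp only [hb0, if_false, zero_mul, mul_zero]
    apply tendsto_cesaro_of_eventually_zero
    -- Two solutions of `a + n • b = 0` would make `b` torsion, so the terms vanish from some point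
    -- on.
    by_cases hex : ∃ n₀ : ℕ, a + n₀ • b = 0
    · obtain ⟨n₀, hn₀⟩ := hex
      filter_upwards [eventually_gt_atTop n₀] with n hn
      rw [if_neg, zero_mul]
      intro h
      refine hb0 (hdiv b (n - n₀) (by omega) ?_)
      have h1 : n • b = (n - n₀) • b + n₀ • b := by rw [← add_smul]; congr 1; omega
      rw [h1, add_left_comm, hn₀, add_zero] at h
      exact h
    · push Not at hex
      exact .of_forall fun n => by rw [if_neg (hex n), zero_mul]
  simp only [hb0, smul_zero, add_zero, if_true, one_mul, AddMonoidHom.zero_apply, zero_add,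
    sub_zero]
  by_cases ha0 : a = 0
  swap
  · simp only [ha0, if_false, zero_mul]
    exact tendsto_cesaro_of_eventually_zero (.of_forall fun _ => rfl)
  simp only [ha0, if_true, one_mul]
  by_cases he0 : e = 0
  · simpa [he0] using hκ ω hωc
  · simp only [he0, if_false, zero_mul]
    -- The linear coefficient is `2 • e α`, of infinite order because `e ≠ 0`; nothing is needed
    -- about the quadratic one.
    refine tendsto_cesaro_weyl fun n hn => ?_
    rw [smul_smul]
    exact hα e hec he0 _ (by positivity)

end Equidistribution

/-! ### Approximation in mean -/

section Approximation

/-- Convergence of integrals passes to functions approximable in mean, uniformly along the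
sequence of measures. -/
lemma tendsto_integral_of_approximable {Y : Type*} [MeasurableSpace Y] {μs : ℕ → Measure Y}
    {μ : Measure Y} {F : Y → ℝ} (hF : ∀ N, Integrable F (μs N)) (hF' : Integrable F μ)
    (h : ∀ ε > 0, ∃ H D : Y → ℝ, (∀ y, |F y - H y| ≤ D y) ∧
      (∀ N, Integrable H (μs N)) ∧ Integrable H μ ∧ (∀ N, Integrable D (μs N)) ∧ Integrable D μ ∧
      (∀ᶠ N in atTop, ∫ y, D y ∂μs N ≤ ε) ∧ ∫ y, D y ∂μ ≤ ε ∧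
      Tendsto (fun N => ∫ y, H y ∂μs N) atTop (𝓝 (∫ y, H y ∂μ))) :
    Tendsto (fun N => ∫ y, F y ∂μs N) atTop (𝓝 (∫ y, F y ∂μ)) := by
  rw [Metric.tendsto_nhds]
  intro ε hε
  obtain ⟨H, D, hFH, hH, hH', hD, hD', hDs, hDμ, hlim⟩ := h (ε / 3) (by positivity)
  have hb : ∀ ν : Measure Y, Integrable F ν → Integrable H ν → Integrable D ν →
      ∫ y, D y ∂ν ≤ ε / 3 → dist (∫ y, F y ∂ν) (∫ y, H y ∂ν) ≤ ε / 3 := by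
    intro ν h1 h2 h3 h4
    rw [Real.dist_eq, ← integral_sub h1 h2]
    exact (abs_integral_le_integral_abs).trans
      ((integral_mono (h1.sub h2).abs h3 hFH).trans h4)
  filter_upwards [hDs, Metric.tendsto_nhds.1 hlim (ε / 3) (by positivity)] with N hN1 hN2
  have h1 := hb _ (hF N) (hH N) (hD N) hN1
  have h2 := hb _ hF' hH' hD' hDμ
  rw [dist_comm] at h2
  linarith [dist_triangle4 (∫ y, F y ∂μs N) (∫ y, H y ∂μs N) (∫ y, H y ∂μ) (∫ y, F y ∂μ)]

/-- A bounded measurable function is approximable in mean by continuous functions with the same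
bound. -/
lemma exists_continuous_integral_sub_le {X : Type*} [TopologicalSpace X] [NormalSpace X]
    [MeasurableSpace X] [BorelSpace X] (μ : Measure X) [μ.WeaklyRegular] [IsFiniteMeasure μ]
    {f : X → ℝ} (hf : Measurable f) {C : ℝ} (hC : ∀ x, |f x| ≤ C) {ε : ℝ} (hε : 0 < ε) :
    ∃ φ : X → ℝ, Continuous φ ∧ (∀ x, |φ x| ≤ C) ∧ ∫ x, |f x - φ x| ∂μ ≤ ε := by
  have hfi : Integrable f μ := Integrable.of_bound hf.aestronglyMeasurable C (.of_forall hC)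
  obtain ⟨g, hg, hgi⟩ := hfi.exists_boundedContinuous_integral_sub_le hε
  -- Truncating to `[-C, C]` does not increase the distance to `f`, whose values already lie there.
  have hφ : Continuous fun x => max (-C) (min C (g x)) := by fun_prop
  have hφC : ∀ x, |max (-C) (min C (g x))| ≤ C := fun x => by
    have := (abs_nonneg _).trans (hC x)
    rw [abs_le]
    exact ⟨le_max_left _ _, max_le (by linarith) (min_le_left _ _)⟩
  refine ⟨_, hφ, hφC, le_trans (integral_mono ?_ (hfi.sub hgi).norm fun x => ?_) hg⟩
  · exact (hfi.sub (Integrable.of_bound hφ.measurable.aestronglyMeasurable C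
      (.of_forall hφC))).abs
  · have h1 := abs_le.1 (hC x)
    simp only [Pi.sub_apply, Real.norm_eq_abs]
    have h2 := hφC x
    grind

/-- Telescoping: the three factors are replaced one at a time. -/
lemma abs_mul_mul_mul_sub_le {a b c a' b' c' h C M : ℝ} (hb : |b| ≤ C) (hc : |c| ≤ C)
    (ha' : |a'| ≤ C) (hb' : |b'| ≤ C) (hh : |h| ≤ M) :
    |a * b * c * h - a' * b' * c' * h| ≤
      C ^ 2 * M * (|a - a'| + |b - b'| + |c - c'|) := by
  have hC : 0 ≤ C := (abs_nonneg _).trans hb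
  have e : a * b * c * h - a' * b' * c' * h =
      ((a - a') * (b * c) + (b - b') * (a' * c) + (c - c') * (a' * b')) * h := by ring
  have key : ∀ u v w : ℝ, |v| ≤ C → |w| ≤ C → |u * (v * w)| ≤ C ^ 2 * |u| := by
    intro u v w hv hw
    rw [abs_mul, abs_mul, mul_comm, sq]
    exact mul_le_mul_of_nonneg_right (mul_le_mul hv hw (abs_nonneg _) hC) (abs_nonneg _)
  rw [e, abs_mul]
  calc _ ≤ (C ^ 2 * |a - a'| + C ^ 2 * |b - b'| + C ^ 2 * |c - c'|) * M := by
        refine mul_le_mul ((abs_add_three _ _ _).trans ?_) hh (abs_nonneg _) (by positivity)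
        exact add_le_add (add_le_add (key _ _ _ hb hc) (key _ _ _ ha' hc)) (key _ _ _ ha' hb')
    _ = _ := by ring

end Approximation

/-! ### From continuous to bounded measurable functions -/

section BoundedMeasurable

variable {Z W : Type*} [AddCommGroup Z] [TopologicalSpace Z] [IsTopologicalAddGroup Z]
  [CompactSpace Z] [T2Space Z]
  [SecondCountableTopology Z] [MeasurableSpace Z] [BorelSpace Z] [AddCommGroup W]
  [TopologicalSpace W] [IsTopologicalAddGroup W] [CompactSpace W]
  [SecondCountableTopology W] [MeasurableSpace W] [BorelSpace W]
  {m : Measure Z} [m.IsAddLeftInvariant] [IsProbabilityMeasure m]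

/-- The three projections to points of `Z × Z`. -/
def vertex : Fin 3 → (Z × Z) × (Z × Z) × (Z × Z) × W → Z × Z
  | 0, v => v.1
  | 1, v => v.2.1
  | 2, v => v.2.2.1

lemma continuous_vertex (i : Fin 3) :
    Continuous (vertex i : (Z × Z) × (Z × Z) × (Z × Z) × W → Z × Z) := by
  match i with
  | 0 => exact continuous_fst
  | 1 => exact continuous_snd.fst
  | 2 => exact continuous_snd.snd.fst

lemma vertex_orbitPoint (i : Fin 3) (α : Z) (β : W) (n : ℕ) (p : Z × Z) :
    vertex i (orbitPoint α β n p) = (skewMap α)^[i * n] p := by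
  fin_cases i <;> simp [vertex, orbitPoint]

/-- The skew product preserves `m.prod m`, so each of the three points has exactly this law for
every `N > 0`. Errors in mean are thus uniform in `N`. -/
lemma integral_vertex_orbitMeasure (i : Fin 3) (α : Z) (β : W) {φ : Z × Z → ℝ}
    (hφ : Measurable φ) {C : ℝ} (hC : ∀ p, |φ p| ≤ C) {N : ℕ} (hN : 0 < N) :
    ∫ v, φ (vertex i v) ∂(orbitMeasure m α β N) = ∫ p, φ p ∂(m.prod m) := by
  rw [integral_orbitMeasure m α β (F := fun v => φ (vertex i v)) (C := C)
    (hφ.comp (continuous_vertex i).measurable) (fun v => hC _)]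
  have : ∀ n, ∫ p, φ (vertex i (orbitPoint α β n p)) ∂(m.prod m) = ∫ p, φ p ∂(m.prod m) := by
    intro n
    simp_rw [vertex_orbitPoint]
    have hmp := (measurePreserving_skewMap m α).iterate (i * n)
    conv_rhs => rw [← hmp.map_eq]
    rw [integral_map hmp.measurable.aemeasurable hφ.aestronglyMeasurable]
  have hN' : (N : ℝ) ≠ 0 := by exact_mod_cast hN.ne'
  simp [this, hN']

/-- The marginals pass to the weak limit, and continuous functions determine a finite measure. -/
lemma map_vertex_progressionMeasure {κ : Measure (Z × W)} [IsProbabilityMeasure κ] {α : Z} {β : W}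
    (hlim : ∀ H : (Z × Z) × (Z × Z) × (Z × Z) × W → ℝ, Continuous H →
      Tendsto (fun N => ∫ v, H v ∂(orbitMeasure m α β N)) atTop
        (𝓝 (∫ v, H v ∂(progressionMeasure m κ)))) (i : Fin 3) :
    (progressionMeasure m κ).map (vertex i) = m.prod m := by
  have hv : Measurable (vertex i : (Z × Z) × (Z × Z) × (Z × Z) × W → Z × Z) :=
    (continuous_vertex i).measurable
  have := Measure.isProbabilityMeasure_map (μ := progressionMeasure m κ) hv.aemeasurable
  let := TopologicalSpace.pseudoMetrizableSpacePseudoMetric (Z × Z)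
  refine ext_of_forall_integral_eq_of_IsFiniteMeasure fun φ => ?_
  rw [integral_map hv.aemeasurable φ.continuous.measurable.aestronglyMeasurable]
  refine tendsto_nhds_unique (hlim _ (φ.continuous.comp (continuous_vertex i))) ?_
  refine tendsto_const_nhds.congr' ?_
  filter_upwards [eventually_gt_atTop 0] with N hN
  exact (integral_vertex_orbitMeasure i α β φ.continuous.measurable (C := ‖φ‖)
    (fun p => φ.norm_coe_le_norm p) hN).symm

/-- Convergence of the ergodic averages along squares, for a continuous weight. -/
theorem tendsto_integral_orbitMeasure {κ : Measure (Z × W)} [IsProbabilityMeasure κ] {α : Z} {β : W}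
    (hlim : ∀ H : (Z × Z) × (Z × Z) × (Z × Z) × W → ℝ, Continuous H →
      Tendsto (fun N => ∫ v, H v ∂(orbitMeasure m α β N)) atTop
        (𝓝 (∫ v, H v ∂(progressionMeasure m κ))))
    {f : Z × Z → ℝ} (hf : Measurable f) {C : ℝ} (hC : ∀ p, |f p| ≤ C) {h : W → ℝ}
    (hh : Continuous h) :
    Tendsto (fun N => ∫ v, f v.1 * f v.2.1 * f v.2.2.1 * h v.2.2.2 ∂(orbitMeasure m α β N)) atTop
      (𝓝 (∫ v, f v.1 * f v.2.1 * f v.2.2.1 * h v.2.2.2 ∂(progressionMeasure m κ))) := by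
  obtain ⟨M, hM⟩ : ∃ M, ∀ w, |h w| ≤ M := by
    obtain ⟨M, hM⟩ := (isCompact_range hh).isBounded.exists_norm_le
    exact ⟨M, fun w => hM _ ⟨w, rfl⟩⟩
  have hC0 : 0 ≤ C := (abs_nonneg _).trans (hC 0)
  have hM0 : 0 ≤ M := (abs_nonneg _).trans (hM 0)
  have hmeas : ∀ {φ : Z × Z → ℝ}, Measurable φ →
      Measurable fun v : (Z × Z) × (Z × Z) × (Z × Z) × W =>
        φ v.1 * φ v.2.1 * φ v.2.2.1 * h v.2.2.2 := fun hφ =>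
    (((hφ.comp measurable_fst).mul (hφ.comp measurable_snd.fst)).mul
      (hφ.comp measurable_snd.snd.fst)).mul (hh.measurable.comp measurable_snd.snd.snd)
  have hbd : ∀ {φ : Z × Z → ℝ}, (∀ p, |φ p| ≤ C) → ∀ v : (Z × Z) × (Z × Z) × (Z × Z) × W,
      ‖φ v.1 * φ v.2.1 * φ v.2.2.1 * h v.2.2.2‖ ≤ C * C * C * M := fun hφ v => by
    simp only [norm_mul, Real.norm_eq_abs]
    gcongr <;> first | exact hφ _ | exact hM _
  have hint : ∀ {φ : Z × Z → ℝ}, Measurable φ → (∀ p, |φ p| ≤ C) →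
      ∀ (ν : Measure ((Z × Z) × (Z × Z) × (Z × Z) × W)) [IsFiniteMeasure ν],
      Integrable (fun v => φ v.1 * φ v.2.1 * φ v.2.2.1 * h v.2.2.2) ν := fun hφ hφC ν _ =>
    Integrable.of_bound (hmeas hφ).aestronglyMeasurable _ (.of_forall (hbd hφC))
  refine tendsto_integral_of_approximable (fun N => hint hf hC _) (hint hf hC _) fun ε hε => ?_
  -- The 3 counts the vertices; the `+ 1` keeps the denominator positive when `C` or `M` is zero.
  obtain ⟨φ, hφ, hφC, hφε⟩ := exists_continuous_integral_sub_le (m.prod m) hf hC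
    (ε := ε / (3 * (C ^ 2 * M + 1))) (by positivity)
  set D : (Z × Z) × (Z × Z) × (Z × Z) × W → ℝ := fun v =>
    C ^ 2 * M * ∑ i, |f (vertex i v) - φ (vertex i v)| with hDdef
  have hδm : Measurable fun p => |f p - φ p| := (hf.sub hφ.measurable).abs
  have hδb : ∀ p, |(|f p - φ p|)| ≤ C + C := fun p => by
    rw [abs_abs]
    exact (abs_sub _ _).trans (add_le_add (hC p) (hφC p))
  have hδi : ∀ i, ∀ (ν : Measure ((Z × Z) × (Z × Z) × (Z × Z) × W)) [IsFiniteMeasure ν],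
      Integrable (fun v => |f (vertex i v) - φ (vertex i v)|) ν := fun i ν _ =>
    Integrable.of_bound (hδm.comp (continuous_vertex i).measurable).aestronglyMeasurable (C + C)
      (.of_forall fun v => hδb _)
  have hDi : ∀ (ν : Measure ((Z × Z) × (Z × Z) × (Z × Z) × W)) [IsFiniteMeasure ν],
      Integrable D ν := fun ν _ => (integrable_finsetSum _ fun i _ => hδi i ν).const_mul _
  have hDε : ∀ (ν : Measure ((Z × Z) × (Z × Z) × (Z × Z) × W)) [IsFiniteMeasure ν],
      (∀ i, ∫ v, |f (vertex i v) - φ (vertex i v)| ∂ν = ∫ p, |f p - φ p| ∂(m.prod m)) →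
      ∫ v, D v ∂ν ≤ ε := by
    intro ν _ hν
    rw [hDdef, integral_const_mul, integral_finsetSum _ fun i _ => hδi i ν]
    simp only [hν, Finset.sum_const, Finset.card_univ, Fintype.card_fin, nsmul_eq_mul]
    have h1 : C ^ 2 * M * (3 * ∫ p, |f p - φ p| ∂(m.prod m)) ≤
        C ^ 2 * M * (3 * (ε / (3 * (C ^ 2 * M + 1)))) := by gcongr
    refine le_trans (by exact_mod_cast h1) ?_
    have h2 : C ^ 2 * M * (3 * (ε / (3 * (C ^ 2 * M + 1)))) =
        ε * (C ^ 2 * M / (C ^ 2 * M + 1)) := by field_simp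
    rw [h2]
    exact mul_le_of_le_one_right hε.le
      ((div_le_one (by positivity)).2 (by linarith))
  refine ⟨fun v => φ v.1 * φ v.2.1 * φ v.2.2.1 * h v.2.2.2, D, fun v => ?_,
    fun N => hint hφ.measurable hφC _, hint hφ.measurable hφC _, fun N => hDi _, hDi _, ?_, ?_,
    hlim _ ?_⟩
  · have := abs_mul_mul_mul_sub_le (a := f v.1) (c' := φ v.2.2.1) (hC v.2.1) (hC v.2.2.1)
      (hφC v.1) (hφC v.2.1) (hM v.2.2.2)
    simpa [hDdef, Fin.sum_univ_three, vertex] using this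
  · filter_upwards [eventually_gt_atTop 0] with N hN
    exact hDε _ fun i => integral_vertex_orbitMeasure i α β hδm hδb hN
  · refine hDε _ fun i => ?_
    rw [← map_vertex_progressionMeasure hlim i, integral_map
      (continuous_vertex i).measurable.aemeasurable hδm.aestronglyMeasurable]
  · fun_prop

end BoundedMeasurable

/-! ### Riemann integrable functions: boundedness and almost everywhere continuity -/

section RiemannIntegrable

open BoxIntegral

lemma hasIntegralVertices_unitBox (r : ℕ) : hasIntegralVertices (unitBox r) :=
  ⟨fun _ => 0, fun _ => 1, fun _ => by simp [unitBox], fun _ => by simp [unitBox]⟩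

/-- For a Riemann integrable function there are partitions of the unit box such that changing the
tags changes the Riemann sums arbitrarily little. -/
lemma exists_partition_sum_sub_le {r : ℕ} {F : (Fin r → ℝ) → ℝ}
    (hF : BoxIntegral.Integrable (unitBox r) IntegrationParams.Riemann F
      (BoxAdditiveMap.volume : BoxAdditiveMap (Fin r) (ℝ →L[ℝ] ℝ) ⊤)) {ε : ℝ} (hε : 0 < ε) :
    ∃ π : TaggedPrepartition (unitBox r), π.IsPartition ∧ π.IsHenstock ∧
      ∀ σ τ : Box (Fin r) → Fin r → ℝ, (∀ J ∈ π.boxes, σ J ∈ Box.Icc J) →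
        (∀ J ∈ π.boxes, τ J ∈ Box.Icc J) →
        ∑ J ∈ π.boxes, volume.real (J : Set (Fin r → ℝ)) * (F (σ J) - F (τ J)) ≤ ε := by
  classical
  obtain ⟨y, hy⟩ := hF
  obtain ⟨ρ, hρ, H⟩ := hasIntegral_iff.1 hy (ε / 2) (by positivity)
  -- For the Riemann filter the gauge `ρ 0` is constant, so a grid of mesh `1 / (k + 1)` below it is
  -- subordinate whatever the tags.
  obtain ⟨k, hk⟩ := exists_nat_one_div_lt (show (0 : ℝ) < ρ 0 0 from (ρ 0 0).2)
  set π := unitPartition.prepartition (k + 1) (unitBox r)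
  have hpart : π.IsPartition :=
    unitPartition.prepartition_isPartition (k + 1) (hasIntegralVertices_unitBox r)
  refine ⟨π, hpart, unitPartition.prepartition_isHenstock _ _, fun σ τ hσ hτ => ?_⟩
  have key : ∀ σ : Box (Fin r) → Fin r → ℝ, (∀ J ∈ π.boxes, σ J ∈ Box.Icc J) →
      |∑ J ∈ π.boxes, volume.real (J : Set (Fin r → ℝ)) * F (σ J) - y| ≤ ε / 2 := by
    intro σ hσ
    let π' : TaggedPrepartition (unitBox r) :=
      { π.toPrepartition with
        tag := fun J => if J ∈ π.boxes then σ J else π.tag J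
        tag_mem_Icc := fun J => by
          split_ifs with hJ
          · exact Box.le_iff_Icc.1 (π.le_of_mem' J hJ) (hσ J hJ)
          · exact π.tag_mem_Icc J }
    have htag : ∀ J ∈ π.boxes, π'.tag J = σ J := fun J hJ => if_pos hJ
    have hsub : IntegrationParams.Riemann.MemBaseSet (unitBox r) 0 (ρ 0) π' :=
      { isSubordinate := fun J hJ x hx => by
          have hJ' : J ∈ π.boxes := hJ
          rw [htag J hJ', hρ 0 rfl]
          obtain ⟨ν, hν, rfl⟩ := unitPartition.mem_prepartition_boxes_iff.1 hJ'
          refine (Metric.dist_le_diam_of_mem (Box.isBounded_Icc _) hx (hσ _ hJ')).trans ?_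
          refine (unitPartition.diam_boxIcc (k + 1) ν).trans ?_
          push_cast
          exact hk.le
        isHenstock := fun _ J hJ => by
          have hJ' : J ∈ π.boxes := hJ
          rw [htag J hJ']
          exact hσ J hJ'
        distortion_le := fun h => by simp [IntegrationParams.Riemann] at h
        exists_compl := fun h => by simp [IntegrationParams.Riemann] at h }
    have h1 := H 0 π' hsub hpart
    rw [Real.dist_eq] at h1
    convert h1 using 3
    unfold integralSum
    refine Finset.sum_congr rfl fun J hJ => ?_
    rw [htag J hJ, BoxAdditiveMap.volume_apply, measureReal_def, Box.volume_apply', smul_eq_mul]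
  have h1 := abs_le.1 (key σ hσ)
  have h2 := abs_le.1 (key τ hτ)
  simp only [mul_sub, Finset.sum_sub_distrib]
  linarith

lemma measureReal_box_pos {r : ℕ} (J : Box (Fin r)) : 0 < volume.real (J : Set (Fin r → ℝ)) := by
  rw [measureReal_def, Box.volume_apply']
  exact Finset.prod_pos fun i _ => sub_pos.2 (J.lower_lt_upper i)

/-- A Riemann integrable function is bounded. -/
lemma exists_bound_of_riemannIntegrable {r : ℕ} {F : (Fin r → ℝ) → ℝ}
    (hF : BoxIntegral.Integrable (unitBox r) IntegrationParams.Riemann F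
      (BoxAdditiveMap.volume : BoxAdditiveMap (Fin r) (ℝ →L[ℝ] ℝ) ⊤)) :
    ∃ M, ∀ x ∈ unitBox r, |F x| ≤ M := by
  classical
  obtain ⟨π, hpart, hH, hπ⟩ := exists_partition_sum_sub_le hF one_pos
  refine ⟨∑ J ∈ π.boxes, (|F (π.tag J)| + 1 / volume.real (J : Set (Fin r → ℝ))),
    fun x hx => ?_⟩
  obtain ⟨J, hJ, hxJ⟩ := hpart x hx
  have hJ' : J ∈ π.boxes := hJ
  have hv := measureReal_box_pos J
  -- Changing the tag in the single box `J` isolates one term of the sum, which bounds the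
  -- oscillation of `F` on `J`.
  have osc : ∀ a ∈ Box.Icc J, ∀ b ∈ Box.Icc J,
      volume.real (J : Set (Fin r → ℝ)) * (F a - F b) ≤ 1 := by
    intro a ha b hb
    have h := hπ (Function.update π.tag J a) (Function.update π.tag J b)
      (fun K hK => by
        by_cases h : K = J
        · subst h; simpa using ha
        · simpa [h] using hH K hK)
      (fun K hK => by
        by_cases h : K = J
        · subst h; simpa using hb
        · simpa [h] using hH K hK)
    rw [Finset.sum_eq_single_of_mem J hJ' fun K _ hKJ => by simp [hKJ]] at h
    simpa using h
  have hxI := Box.coe_subset_Icc hxJ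
  have h1 := osc x hxI _ (hH J hJ)
  have h2 := osc _ (hH J hJ) x hxI
  rw [mul_comm, ← le_div_iff₀ hv] at h1 h2
  have h3 : |F x| ≤ |F (π.tag J)| + 1 / volume.real (J : Set (Fin r → ℝ)) := by
    rw [abs_le]
    constructor <;> cases abs_cases (F (π.tag J)) <;> linarith
  exact h3.trans (Finset.single_le_sum
    (f := fun J : Box (Fin r) => |F (π.tag J)| + 1 / volume.real (J : Set (Fin r → ℝ)))
    (fun K _ => add_nonneg (abs_nonneg _) (one_div_nonneg.2 measureReal_nonneg)) hJ')

/-- A Riemann integrable function is continuous almost everywhere. -/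
lemma ae_continuousAt_of_riemannIntegrable {r : ℕ} {F : (Fin r → ℝ) → ℝ}
    (hF : BoxIntegral.Integrable (unitBox r) IntegrationParams.Riemann F
      (BoxAdditiveMap.volume : BoxAdditiveMap (Fin r) (ℝ →L[ℝ] ℝ) ⊤)) :
    ∀ᵐ x ∂(volume.restrict (unitBox r : Set (Fin r → ℝ))), ContinuousAt F x := by
  classical
  have small : ∀ η : ℝ, 0 < η →
      ∀ᵐ x ∂(volume.restrict (unitBox r : Set (Fin r → ℝ))), ∀ᶠ y in 𝓝 x, |F y - F x| < η := by
    intro η hη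
    rw [ae_restrict_iff' (unitBox r).measurableSet_coe, ae_iff]
    set E := {x | ¬(x ∈ (unitBox r : Set (Fin r → ℝ)) → ∀ᶠ y in 𝓝 x, |F y - F x| < η)}
    suffices h : ∀ ε : ℝ, 0 < ε → volume E ≤ ENNReal.ofReal ε by
      refine le_antisymm (ENNReal.le_of_forall_pos_le_add fun ε hε _ => ?_) zero_le
      rw [zero_add]
      simpa using h ε hε
    intro ε hε
    -- A Chebyshev argument: each box on which `F` oscillates by at least `η` contributes `η` times
    -- its volume, so a total of `η * ε` forces such boxes to have volume at most `ε`. Elsewhere,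
    -- off the null set of faces, the oscillation is below `η`.
    obtain ⟨π, hpart, hH, hπ⟩ := exists_partition_sum_sub_le hF (mul_pos hη hε)
    let P : Box (Fin r) → Prop := fun J => ∃ a ∈ Box.Icc J, ∃ b ∈ Box.Icc J, η ≤ F a - F b
    let σ : Box (Fin r) → Fin r → ℝ := fun J => if h : P J then h.choose else π.tag J
    let τ : Box (Fin r) → Fin r → ℝ := fun J =>
      if h : P J then h.choose_spec.2.choose else π.tag J
    have hsum := hπ σ τ
      (fun J hJ => by
        by_cases h : P J
        · simp only [σ, dif_pos h]; exact h.choose_spec.1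
        · simp only [σ, dif_neg h]; exact hH J hJ)
      (fun J hJ => by
        by_cases h : P J
        · simp only [τ, dif_pos h]; exact h.choose_spec.2.choose_spec.1
        · simp only [τ, dif_neg h]; exact hH J hJ)
    have hbad : ∑ J ∈ π.boxes with P J, volume.real (J : Set (Fin r → ℝ)) ≤ ε := by
      rw [← mul_le_mul_iff_right₀ hη]
      refine le_trans ?_ hsum
      rw [Finset.mul_sum, Finset.sum_filter]
      refine Finset.sum_le_sum fun J _ => ?_
      split_ifs with h
      · simp only [σ, τ, dif_pos h]
        rw [mul_comm]
        exact mul_le_mul_of_nonneg_left h.choose_spec.2.choose_spec.2 measureReal_nonneg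
      · simp [σ, τ, dif_neg h]
    have hsubset : E ⊆ (⋃ J ∈ π.boxes.filter P, (J : Set (Fin r → ℝ))) ∪
        ⋃ J ∈ π.boxes, ((J : Set (Fin r → ℝ)) \ Box.Ioo J) := by
      intro x hx
      simp only [E, Set.mem_ofPred_eq, Classical.not_imp] at hx
      obtain ⟨hxB, hx⟩ := hx
      obtain ⟨J, hJ, hxJ⟩ := hpart x hxB
      by_cases hP : P J
      · exact Or.inl (Set.mem_biUnion (Finset.mem_filter.2 ⟨hJ, hP⟩) hxJ)
      · refine Or.inr (Set.mem_biUnion (show J ∈ π.boxes from hJ) ⟨hxJ, fun hxI => hx ?_⟩)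
        have hopen : IsOpen (Box.Ioo J) := isOpen_set_pi Set.finite_univ fun i _ => isOpen_Ioo
        filter_upwards [hopen.mem_nhds hxI] with y hy
        have hy' := Box.Ioo_subset_Icc J hy
        have hx' := Box.Ioo_subset_Icc J hxI
        simp only [P, not_exists, not_and, not_le] at hP
        rw [abs_lt]
        constructor
        · linarith [hP x hx' y hy']
        · exact hP y hy' x hx'
    have hnull : volume (⋃ J ∈ π.boxes, ((J : Set (Fin r → ℝ)) \ Box.Ioo J)) = 0 := by
      refine (measure_biUnion_null_iff (I := (π.boxes : Set (Box (Fin r))))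
        π.boxes.countable_toSet).2 fun J _ => ?_
      exact ae_le_set.1 (J.coe_ae_eq_Icc.trans J.Ioo_ae_eq_Icc.symm).le
    calc volume E ≤ volume (⋃ J ∈ π.boxes.filter P, (J : Set (Fin r → ℝ))) + 0 := by
          rw [← hnull]
          exact (measure_mono hsubset).trans (measure_union_le _ _)
      _ ≤ ∑ J ∈ π.boxes with P J, volume (J : Set (Fin r → ℝ)) := by
          rw [add_zero]
          exact measure_biUnion_finset_le _ _
      _ = ENNReal.ofReal (∑ J ∈ π.boxes with P J, volume.real (J : Set (Fin r → ℝ))) := by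
          rw [ENNReal.ofReal_sum_of_nonneg fun _ _ => measureReal_nonneg]
          refine Finset.sum_congr rfl fun J _ => ?_
          rw [ofReal_measureReal (J.measure_coe_lt_top _).ne]
      _ ≤ ENNReal.ofReal ε := ENNReal.ofReal_le_ofReal hbad
  have hall := ae_all_iff.2 fun k : ℕ => small (1 / ((k : ℝ) + 1)) (by positivity)
  filter_upwards [hall] with x hx
  rw [ContinuousAt, Metric.tendsto_nhds]
  intro ε hε
  obtain ⟨k, hk⟩ := exists_nat_one_div_lt hε
  filter_upwards [hx k] with y hy
  rw [Real.dist_eq]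
  exact hy.trans hk

/-- The quotient map from the unit box to the torus preserves volume. -/
lemma measurePreserving_unitBox_torus (r : ℕ) :
    MeasurePreserving (fun (x : Fin r → ℝ) i => (x i : UnitAddCircle))
      (volume.restrict (unitBox r : Set (Fin r → ℝ))) (volume : Measure (Torus r)) := by
  have h := measurePreserving_pi (fun _ : Fin r => volume.restrict (Set.Ioc (0 : ℝ) (0 + 1)))
    (fun _ => (volume : Measure UnitAddCircle)) fun _ => UnitAddCircle.measurePreserving_mk 0
  rw [← Measure.restrict_pi_pi] at h
  have e : (unitBox r : Set (Fin r → ℝ)) = Set.univ.pi fun _ => Set.Ioc (0 : ℝ) (0 + 1) := by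
    rw [Box.coe_eq_pi]
    simp [unitBox]
  rw [e]
  exact h

lemma exists_mem_unitBox {r : ℕ} (p : Torus r) :
    ∃ x ∈ unitBox r, (fun i => (x i : UnitAddCircle)) = p := by
  have h : ∀ i, ∃ x ∈ Set.Ioc (0 : ℝ) (0 + 1), (x : UnitAddCircle) = p i := fun i => by
    have := AddCircle.coe_image_Ioc_eq (1 : ℝ) 0
    have hp : p i ∈ (Set.univ : Set UnitAddCircle) := trivial
    rw [← this] at hp
    exact hp
  choose x hx hxp using h
  refine ⟨x, fun i => ?_, funext hxp⟩
  simpa [unitBox] using hx i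

lemma RiemannIntegrableOnTorus.exists_bound {r : ℕ} {g : Torus r → ℝ}
    (hg : RiemannIntegrableOnTorus g) : ∃ M, ∀ p, |g p| ≤ M := by
  obtain ⟨M, hM⟩ := exists_bound_of_riemannIntegrable hg
  refine ⟨M, fun p => ?_⟩
  obtain ⟨x, hx, rfl⟩ := exists_mem_unitBox p
  exact hM x hx

/-- Continuity of the periodic lift at a point descends to `g` because the quotient map is open. -/
lemma RiemannIntegrableOnTorus.ae_continuousAt {r : ℕ} {g : Torus r → ℝ}
    (hg : RiemannIntegrableOnTorus g) : ∀ᵐ p, ContinuousAt g p := by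
  have hmp := measurePreserving_unitBox_torus r
  rw [← hmp.map_eq, ae_map_iff hmp.measurable.aemeasurable (measurableSet_of_continuousAt g)]
  filter_upwards [ae_continuousAt_of_riemannIntegrable hg] with x hx
  have hopen : IsOpenMap (Pi.map fun (_ : Fin r) (t : ℝ) => (t : UnitAddCircle)) :=
    IsOpenMap.piMap (fun _ => QuotientAddGroup.isOpenMap_coe)
      (.of_forall fun _ => QuotientAddGroup.mk_surjective)
  exact (tendsto_map'_iff.2 hx).mono_left (hopen.nhds_le x)

end RiemannIntegrable

/-! ### Lipschitz envelopes and squeezing between continuous functions -/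

section Envelopes

variable {X : Type*} [PseudoMetricSpace X]

/-- The smallest `n`-Lipschitz function above `g`. -/
noncomputable def lipschitzEnvelope (g : X → ℝ) (n : ℕ) (x : X) : ℝ := ⨆ y, (g y - n * dist x y)

variable {g : X → ℝ} {M : ℝ}

lemma bddAbove_lipschitzEnvelope (hM : ∀ x, |g x| ≤ M) (n : ℕ) (x : X) :
    BddAbove (Set.range fun y => g y - n * dist x y) :=
  ⟨M, by
    rintro _ ⟨y, rfl⟩
    have := (abs_le.1 (hM y)).2
    have : 0 ≤ n * dist x y := by positivity
    simp only
    linarith⟩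

lemma le_lipschitzEnvelope (hM : ∀ x, |g x| ≤ M) (n : ℕ) (x : X) :
    g x ≤ lipschitzEnvelope g n x := by
  have h := le_ciSup (bddAbove_lipschitzEnvelope hM n x) x
  simp only [dist_self, mul_zero, sub_zero] at h
  exact h

lemma lipschitzEnvelope_le (hM : ∀ x, |g x| ≤ M) (n : ℕ) (x : X) :
    lipschitzEnvelope g n x ≤ M := by
  have : Nonempty X := ⟨x⟩
  refine ciSup_le fun y => ?_
  have := (abs_le.1 (hM y)).2
  have : 0 ≤ n * dist x y := by positivity
  linarith

lemma abs_lipschitzEnvelope_le (hM : ∀ x, |g x| ≤ M) (n : ℕ) (x : X) :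
    |lipschitzEnvelope g n x| ≤ M :=
  abs_le.2 ⟨(abs_le.1 (hM x)).1.trans (le_lipschitzEnvelope hM n x), lipschitzEnvelope_le hM n x⟩

lemma continuous_lipschitzEnvelope (hM : ∀ x, |g x| ≤ M) (n : ℕ) :
    Continuous (lipschitzEnvelope g n) := by
  refine (LipschitzWith.of_le_add_mul n fun x x' => ?_).continuous
  have : Nonempty X := ⟨x⟩
  refine ciSup_le fun y => ?_
  have h1 := le_ciSup (bddAbove_lipschitzEnvelope hM n x') y
  have h2 : (n : ℝ) * dist x' y ≤ n * (dist x x' + dist x y) := by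
    gcongr
    rw [dist_comm x x']
    exact dist_triangle _ _ _
  rw [mul_add] at h2
  simp only [NNReal.coe_natCast]
  unfold lipschitzEnvelope
  linarith

/-- Points within `δ` of `x` contribute at most `g x + ε / 2`. Points farther away contribute at
most `M - n δ ≤ -M ≤ g x` once `n ≥ 2 M / δ`. -/
lemma tendsto_lipschitzEnvelope (hM : ∀ x, |g x| ≤ M) {x : X} (hx : ContinuousAt g x) :
    Tendsto (fun n => lipschitzEnvelope g n x) atTop (𝓝 (g x)) := by
  have : Nonempty X := ⟨x⟩
  rw [Metric.tendsto_nhds]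
  intro ε hε
  obtain ⟨δ, hδ, hgδ⟩ := Metric.continuousAt_iff.1 hx (ε / 2) (by positivity)
  obtain ⟨n₀, hn₀⟩ := exists_nat_ge (2 * M / δ)
  filter_upwards [eventually_ge_atTop n₀] with n hn
  have h1 := le_lipschitzEnvelope hM n x
  have h2 : lipschitzEnvelope g n x ≤ g x + ε / 2 := by
    refine ciSup_le fun y => ?_
    have hd : 0 ≤ n * dist x y := by positivity
    by_cases hy : dist y x < δ
    · have := hgδ hy
      rw [Real.dist_eq, abs_lt] at this
      linarith [this.2]
    · have h3 : 2 * M ≤ n * dist x y := by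
        rw [div_le_iff₀ hδ] at hn₀
        refine hn₀.trans ?_
        rw [dist_comm x y]
        gcongr
        exact not_lt.1 hy
      linarith [(abs_le.1 (hM y)).2, (abs_le.1 (hM x)).1]
  rw [Real.dist_eq, abs_lt]
  constructor <;> linarith

variable [MeasurableSpace X] [BorelSpace X] {μ : Measure X} [IsFiniteMeasure μ]

/-- A bounded almost everywhere continuous function lies between continuous functions with almost
equal integrals. -/
lemma exists_continuous_between (hM : ∀ x, |g x| ≤ M) (hg : ∀ᵐ x ∂μ, ContinuousAt g x)
    {ε : ℝ} (hε : 0 < ε) :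
    ∃ h₁ h₂ : X → ℝ, Continuous h₁ ∧ Continuous h₂ ∧ (∀ x, h₁ x ≤ g x) ∧ (∀ x, g x ≤ h₂ x) ∧
      ∫ x, (h₂ x - h₁ x) ∂μ ≤ ε := by
  -- The lower approximant is minus the upper envelope of `-g`.
  have hM' : ∀ x, |(-g) x| ≤ M := fun x => by simpa using hM x
  have hlim : Tendsto (fun n => ∫ x, (lipschitzEnvelope g n x - -lipschitzEnvelope (-g) n x) ∂μ)
      atTop (𝓝 (∫ _, (0 : ℝ) ∂μ)) := by
    refine tendsto_integral_of_dominated_convergence (fun _ => M + M) (fun n => ?_)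
      (integrable_const _) (fun n => .of_forall fun x => ?_) ?_
    · exact ((continuous_lipschitzEnvelope hM n).sub
        (continuous_lipschitzEnvelope hM' n).neg).measurable.aestronglyMeasurable
    · refine (norm_sub_le _ _).trans ?_
      rw [norm_neg]
      exact add_le_add (abs_lipschitzEnvelope_le hM n x) (abs_lipschitzEnvelope_le hM' n x)
    · filter_upwards [hg] with x hx
      have := (tendsto_lipschitzEnvelope hM hx).sub (tendsto_lipschitzEnvelope hM' hx.neg).neg
      simpa using this
  rw [integral_zero] at hlim
  obtain ⟨n, hn⟩ := (hlim.eventually_lt_const hε).exists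
  exact ⟨fun x => -lipschitzEnvelope (-g) n x, lipschitzEnvelope g n,
    (continuous_lipschitzEnvelope hM' n).neg, continuous_lipschitzEnvelope hM n,
    fun x => neg_le.1 (le_lipschitzEnvelope hM' n x), le_lipschitzEnvelope hM n, hn.le⟩

lemma aemeasurable_of_ae_continuousAt (hM : ∀ x, |g x| ≤ M)
    (hg : ∀ᵐ x ∂μ, ContinuousAt g x) : AEMeasurable g μ :=
  aemeasurable_of_tendsto_metrizable_ae atTop
    (fun n => (continuous_lipschitzEnvelope hM n).measurable.aemeasurable)
    (hg.mono fun _ hx => tendsto_lipschitzEnvelope hM hx)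

/-- A bounded almost everywhere measurable function has a measurable version with the same bound. -/
lemma exists_measurable_version {Y : Type*} [MeasurableSpace Y] {ν : Measure Y} {k : Y → ℝ}
    (hk : AEMeasurable k ν) (hM : ∀ x, |k x| ≤ M) :
    ∃ k' : Y → ℝ, Measurable k' ∧ (∀ x, |k' x| ≤ M) ∧ k =ᵐ[ν] k' := by
  by_cases hY : Nonempty Y
  · obtain ⟨y⟩ := hY
    have hM0 : 0 ≤ M := (abs_nonneg _).trans (hM y)
    refine ⟨fun x => max (-M) (min M (hk.mk k x)),
      measurable_const.max (measurable_const.min hk.measurable_mk), fun x => ?_, ?_⟩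
    · rw [abs_le]
      exact ⟨le_max_left _ _, max_le (by linarith) (min_le_left _ _)⟩
    · filter_upwards [hk.ae_eq_mk] with x hx
      rw [← hx, min_eq_right (abs_le.1 (hM x)).2, max_eq_right (abs_le.1 (hM x)).1]
  · rw [not_nonempty_iff] at hY
    exact ⟨k, measurable_of_empty k, hM, .rfl⟩

end Envelopes

/-! ### From continuous to Riemann integrable weights -/

section RiemannWeights

variable {Z W : Type*} [AddCommGroup Z] [TopologicalSpace Z] [IsTopologicalAddGroup Z]
  [CompactSpace Z] [T2Space Z]
  [SecondCountableTopology Z] [MeasurableSpace Z] [BorelSpace Z] [AddCommGroup W]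
  [TopologicalSpace W] [IsTopologicalAddGroup W] [CompactSpace W]
  [SecondCountableTopology W] [MeasurableSpace W] [BorelSpace W]
  {m : Measure Z} [m.IsAddLeftInvariant] [IsProbabilityMeasure m]

lemma measurePreserving_weight_progressionMeasure {κ : Measure (Z × W)} [IsProbabilityMeasure κ]
    {μ : Measure W} (hκ : κ.map Prod.snd = μ) :
    MeasurePreserving (fun v : (Z × Z) × (Z × Z) × (Z × Z) × W => v.2.2.2)
      (progressionMeasure m κ) μ := by
  refine ⟨measurable_snd.snd.snd, ?_⟩
  rw [progressionMeasure, Measure.map_map measurable_snd.snd.snd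
    continuous_progressionPoint.measurable]
  have h : MeasurePreserving (Prod.snd : Z × W → W) κ μ := ⟨measurable_snd, hκ⟩
  have h1 := h.comp (measurePreserving_snd (μ := m) (ν := κ))
  have h2 := h1.comp (measurePreserving_snd (μ := m) (ν := m.prod κ))
  have h3 := h2.comp (measurePreserving_snd (μ := m) (ν := m.prod (m.prod κ)))
  have h4 := h3.comp (measurePreserving_snd (μ := m) (ν := m.prod (m.prod (m.prod κ))))
  exact h4.map_eq

lemma integral_progressionMeasure {κ : Measure (Z × W)} [IsProbabilityMeasure κ]
    {G : (Z × Z) × (Z × Z) × (Z × Z) × W → ℝ} (hG : Measurable G) {C : ℝ} (hC : ∀ v, |G v| ≤ C) :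
    ∫ v, G v ∂(progressionMeasure m κ) =
      ∫ y, ∫ x, ∫ t, ∫ s, ∫ w, G (progressionPoint (y, x, t, s, w)) ∂κ ∂m ∂m ∂m ∂m := by
  have hGp : Measurable fun v : Z × Z × Z × Z × (Z × W) => G (progressionPoint v) :=
    hG.comp continuous_progressionPoint.measurable
  rw [progressionMeasure, integral_map continuous_progressionPoint.measurable.aemeasurable
    hG.aestronglyMeasurable, integral_prod]
  swap
  · exact Integrable.of_bound hGp.aestronglyMeasurable C (.of_forall fun v => hC _)
  refine integral_congr_ae (.of_forall fun y => ?_)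
  have h1 : Measurable fun v : Z × Z × Z × (Z × W) => G (progressionPoint (y, v)) :=
    hGp.comp measurable_prodMk_left
  simp only
  rw [integral_prod]
  swap
  · exact Integrable.of_bound h1.aestronglyMeasurable C (.of_forall fun v => hC _)
  refine integral_congr_ae (.of_forall fun x => ?_)
  have h2 : Measurable fun v : Z × Z × (Z × W) => G (progressionPoint (y, x, v)) :=
    h1.comp measurable_prodMk_left
  simp only
  rw [integral_prod]
  swap
  · exact Integrable.of_bound h2.aestronglyMeasurable C (.of_forall fun v => hC _)
  refine integral_congr_ae (.of_forall fun t => ?_)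
  have h3 : Measurable fun v : Z × (Z × W) => G (progressionPoint (y, x, t, v)) :=
    h2.comp measurable_prodMk_left
  simp only
  rw [integral_prod]
  exact Integrable.of_bound h3.aestronglyMeasurable C (.of_forall fun v => hC _)

/-- Convergence of the ergodic averages along squares, for weights that lie between continuous
functions with almost equal integrals. -/
theorem tendsto_weighted_average {κ : Measure (Z × W)} [IsProbabilityMeasure κ] {α : Z} {β : W}
    (hlim : ∀ H : (Z × Z) × (Z × Z) × (Z × Z) × W → ℝ, Continuous H →
      Tendsto (fun N => ∫ v, H v ∂(orbitMeasure m α β N)) atTop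
        (𝓝 (∫ v, H v ∂(progressionMeasure m κ))))
    {μ : Measure W} [IsProbabilityMeasure μ] (hκ : κ.map Prod.snd = μ)
    {f : Z × Z → ℝ} (hf : Measurable f) {C : ℝ} (hC : ∀ p, |f p| ≤ C) {g g' : W → ℝ}
    (hg : ∀ ε > 0, ∃ h₁ h₂ : W → ℝ, Continuous h₁ ∧ Continuous h₂ ∧ (∀ x, h₁ x ≤ g x) ∧
      (∀ x, g x ≤ h₂ x) ∧ ∫ x, (h₂ x - h₁ x) ∂μ ≤ ε)
    (hg' : Measurable g') {M : ℝ} (hM : ∀ x, |g' x| ≤ M) (hgg' : g =ᵐ[μ] g') :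
    Tendsto (fun N : ℕ => (1 / (N : ℝ)) * ∑ n ∈ Finset.Icc 1 N, g (n ^ 2 • β) *
        ∫ p, f p * f ((skewMap α)^[n] p) * f ((skewMap α)^[2 * n] p) ∂(m.prod m)) atTop
      (𝓝 (∫ v, f v.1 * f v.2.1 * f v.2.2.1 * g' v.2.2.2 ∂(progressionMeasure m κ))) := by
  have hC0 : 0 ≤ C := (abs_nonneg _).trans (hC 0)
  set c : ℕ → ℝ := fun n =>
    ∫ p, f p * f ((skewMap α)^[n] p) * f ((skewMap α)^[2 * n] p) ∂(m.prod m) with hcdef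
  have hfff : ∀ p q s, |f p * f q * f s| ≤ C * C * C := fun p q s => by
    rw [abs_mul, abs_mul]
    gcongr <;> exact hC _
  have hc : ∀ n, |c n| ≤ C * C * C := fun n => by
    have := norm_integral_le_of_norm_le_const (μ := m.prod m) (C := C * C * C)
      (f := fun p => f p * f ((skewMap α)^[n] p) * f ((skewMap α)^[2 * n] p))
      (.of_forall fun p => hfff _ _ _)
    simpa using this
  have hbdd : ∀ {h : W → ℝ}, Continuous h → ∃ K, ∀ w, |h w| ≤ K := fun {h} hh => by
    obtain ⟨K, hK⟩ := (isCompact_range hh).isBounded.exists_norm_le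
    exact ⟨K, fun w => hK _ ⟨w, rfl⟩⟩
  have hmeas : ∀ {h : W → ℝ}, Measurable h →
      Measurable fun v : (Z × Z) × (Z × Z) × (Z × Z) × W =>
        f v.1 * f v.2.1 * f v.2.2.1 * h v.2.2.2 := fun hh =>
    (((hf.comp measurable_fst).mul (hf.comp measurable_snd.fst)).mul
      (hf.comp measurable_snd.snd.fst)).mul (hh.comp measurable_snd.snd.snd)
  have hbd : ∀ {h : W → ℝ} {K : ℝ}, (∀ w, |h w| ≤ K) →
      ∀ v : (Z × Z) × (Z × Z) × (Z × Z) × W,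
        |f v.1 * f v.2.1 * f v.2.2.1 * h v.2.2.2| ≤ C * C * C * K := fun hK v => by
    rw [abs_mul]
    exact mul_le_mul (hfff _ _ _) (hK _) (abs_nonneg _) (by positivity)
  have hmp := measurePreserving_weight_progressionMeasure (m := m) hκ
  have havg : ∀ {h : W → ℝ}, Continuous h →
      Tendsto (fun N : ℕ => (1 / (N : ℝ)) * ∑ n ∈ Finset.Icc 1 N, h (n ^ 2 • β) * c n) atTop
        (𝓝 (∫ v, f v.1 * f v.2.1 * f v.2.2.1 * h v.2.2.2 ∂(progressionMeasure m κ))) := by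
    intro h hh
    obtain ⟨K, hK⟩ := hbdd hh
    refine (tendsto_integral_orbitMeasure hlim hf hC hh).congr fun N => ?_
    rw [integral_orbitMeasure m α β (hmeas hh.measurable) (hbd hK), smul_eq_mul]
    congr 1
    refine Finset.sum_congr rfl fun n _ => ?_
    simp only [orbitPoint, integral_mul_const]
    rw [mul_comm]
  -- Equidistribution of `n² β` for `μ`: it controls the average of `h₂ - h₁` along the orbit, where
  -- almost everywhere statements about `g` say nothing.
  have havg1 : ∀ {h : W → ℝ}, Continuous h →
      Tendsto (fun N : ℕ => (1 / (N : ℝ)) * ∑ n ∈ Finset.Icc 1 N, h (n ^ 2 • β)) atTop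
        (𝓝 (∫ w, h w ∂μ)) := by
    intro h hh
    obtain ⟨K, hK⟩ := hbdd hh
    have h1 := hlim (fun v => h v.2.2.2) (by fun_prop)
    rw [← hmp.map_eq, integral_map hmp.measurable.aemeasurable hh.measurable.aestronglyMeasurable]
    refine h1.congr fun N => ?_
    rw [integral_orbitMeasure m α β (F := fun v => h v.2.2.2) (C := K)
      (hh.measurable.comp measurable_snd.snd.snd) (fun v => hK _), smul_eq_mul]
    simp [orbitPoint]
  rw [Metric.tendsto_nhds]
  intro ε hε
  set K := C * C * C + 1 with hK
  have hK0 : 0 < K := by positivity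
  have hcK : ∀ n, |c n| ≤ K := fun n => (hc n).trans (by linarith)
  obtain ⟨h₁, h₂, hc₁, hc₂, hl, hu, hδ⟩ := hg (ε / (4 * K)) (by positivity)
  obtain ⟨K₁, hK₁⟩ := hbdd hc₁
  obtain ⟨K₂, hK₂⟩ := hbdd hc₂
  have hdc : Continuous fun w => h₂ w - h₁ w := hc₂.sub hc₁
  -- On the limit side `g` may be replaced by `g'`, since the weight coordinate has law `μ`. The
  -- averages must keep `g` itself, which is sampled at single points.
  have hdiff : dist (∫ v, f v.1 * f v.2.1 * f v.2.2.1 * h₁ v.2.2.2 ∂(progressionMeasure m κ))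
      (∫ v, f v.1 * f v.2.1 * f v.2.2.1 * g' v.2.2.2 ∂(progressionMeasure m κ)) ≤ ε / 4 := by
    have hi1 : Integrable (fun v : (Z × Z) × (Z × Z) × (Z × Z) × W =>
        f v.1 * f v.2.1 * f v.2.2.1 * h₁ v.2.2.2) (progressionMeasure m κ) :=
      Integrable.of_bound (hmeas hc₁.measurable).aestronglyMeasurable _ (.of_forall (hbd hK₁))
    have hi2 : Integrable (fun v : (Z × Z) × (Z × Z) × (Z × Z) × W =>
        f v.1 * f v.2.1 * f v.2.2.1 * g' v.2.2.2) (progressionMeasure m κ) :=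
      Integrable.of_bound (hmeas hg').aestronglyMeasurable _ (.of_forall (hbd hM))
    have hi3 : Integrable (fun w => h₂ w - h₁ w) μ :=
      (Integrable.of_bound hc₂.measurable.aestronglyMeasurable _ (.of_forall hK₂)).sub
        (Integrable.of_bound hc₁.measurable.aestronglyMeasurable _ (.of_forall hK₁))
    have hi4 : Integrable (fun v : (Z × Z) × (Z × Z) × (Z × Z) × W =>
        K * (h₂ v.2.2.2 - h₁ v.2.2.2)) (progressionMeasure m κ) :=
      (hmp.integrable_comp_of_integrable hi3).const_mul K
    have heq := hmp.quasiMeasurePreserving.ae hgg'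
    rw [Real.dist_eq, ← integral_sub hi1 hi2]
    calc _ ≤ ∫ v, K * (h₂ v.2.2.2 - h₁ v.2.2.2) ∂(progressionMeasure m κ) := by
          refine abs_integral_le_integral_abs.trans
            (integral_mono_ae (hi1.sub hi2).abs hi4 ?_)
          filter_upwards [heq] with v hv
          rw [← mul_sub, abs_mul, ← hv]
          refine mul_le_mul ((hfff _ _ _).trans (by linarith)) ?_ (abs_nonneg _) hK0.le
          rw [abs_sub_comm, abs_of_nonneg (sub_nonneg.2 (hl _))]
          linarith [hu v.2.2.2]
      _ = K * ∫ w, (h₂ w - h₁ w) ∂μ := by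
          rw [integral_const_mul, ← hmp.map_eq, integral_map hmp.measurable.aemeasurable
            hdc.measurable.aestronglyMeasurable]
      _ ≤ K * (ε / (4 * K)) := by gcongr
      _ = ε / 4 := by field_simp
  have hE := (havg1 hdc).eventually_lt_const
    (show ∫ x, (h₂ x - h₁ x) ∂μ < ε / (2 * K) from hδ.trans_lt (by gcongr; linarith))
  filter_upwards [hE, Metric.tendsto_nhds.1 (havg hc₁) (ε / 4) (by positivity)] with N hN1 hN2
  have hN3 : dist ((1 / (N : ℝ)) * ∑ n ∈ Finset.Icc 1 N, g (n ^ 2 • β) * c n)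
      ((1 / (N : ℝ)) * ∑ n ∈ Finset.Icc 1 N, h₁ (n ^ 2 • β) * c n) ≤ ε / 2 := by
    rw [Real.dist_eq, ← mul_sub, ← Finset.sum_sub_distrib, abs_mul, abs_of_nonneg (by positivity)]
    calc _ ≤ 1 / (N : ℝ) * ∑ n ∈ Finset.Icc 1 N, (h₂ (n ^ 2 • β) - h₁ (n ^ 2 • β)) * K := by
          gcongr
          refine (Finset.abs_sum_le_sum_abs _ _).trans (Finset.sum_le_sum fun n _ => ?_)
          rw [← sub_mul, abs_mul, abs_of_nonneg (sub_nonneg.2 (hl _))]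
          refine mul_le_mul ?_ (hcK n) (abs_nonneg _) ?_
          · linarith [hu (n ^ 2 • β)]
          · linarith [hu (n ^ 2 • β), hl (n ^ 2 • β)]
      _ = (1 / (N : ℝ) * ∑ n ∈ Finset.Icc 1 N, (h₂ (n ^ 2 • β) - h₁ (n ^ 2 • β))) * K := by
          rw [← Finset.sum_mul, mul_assoc]
      _ ≤ ε / (2 * K) * K := by gcongr
      _ = ε / 2 := by field_simp
  refine lt_of_le_of_lt (dist_triangle4 _ _ _ _) (lt_of_lt_of_le
    (add_lt_add_of_lt_of_le (add_lt_add_of_le_of_lt hN3 hN2) hdiff) (by linarith))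

end RiemannWeights

/-! ### Assembly on tori -/

section Main

lemma exists_character_separating_torus {n : ℕ} (x y : Torus n) (h : x ≠ y) :
    ∃ ψ : Torus n →+ UnitAddCircle, Continuous ψ ∧ ψ x ≠ ψ y := by
  obtain ⟨i, hi⟩ := Function.ne_iff.1 h
  exact ⟨Pi.evalAddMonoidHom _ i, continuous_apply i, hi⟩

lemma exists_character_separating_prod {A B : Type*} [AddCommGroup A] [TopologicalSpace A]
    [AddCommGroup B] [TopologicalSpace B]
    (hA : ∀ x y : A, x ≠ y → ∃ ψ : A →+ UnitAddCircle, Continuous ψ ∧ ψ x ≠ ψ y)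
    (hB : ∀ x y : B, x ≠ y → ∃ ψ : B →+ UnitAddCircle, Continuous ψ ∧ ψ x ≠ ψ y)
    (x y : A × B) (h : x ≠ y) : ∃ ψ : A × B →+ UnitAddCircle, Continuous ψ ∧ ψ x ≠ ψ y := by
  by_cases h1 : x.1 = y.1
  · obtain ⟨ψ, hψ, hne⟩ := hB x.2 y.2 fun h2 => h (Prod.ext h1 h2)
    exact ⟨ψ.comp (AddMonoidHom.snd A B), hψ.comp continuous_snd, hne⟩
  · obtain ⟨ψ, hψ, hne⟩ := hA x.1 y.1 h1
    exact ⟨ψ.comp (AddMonoidHom.fst A B), hψ.comp continuous_fst, hne⟩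

lemma tendsto_integral_orbitMeasure_of_characters {Z W : Type*} [AddCommGroup Z]
    [TopologicalSpace Z] [IsTopologicalAddGroup Z] [CompactSpace Z]
    [SecondCountableTopology Z] [MeasurableSpace Z] [BorelSpace Z] [AddCommGroup W]
    [TopologicalSpace W] [IsTopologicalAddGroup W] [CompactSpace W]
    [SecondCountableTopology W] [MeasurableSpace W] [BorelSpace W]
    {m : Measure Z} [m.IsAddLeftInvariant] [IsProbabilityMeasure m]
    {κ : Measure (Z × W)} [IsProbabilityMeasure κ] {α : Z} {β : W}
    (hZ : ∀ x y : Z, x ≠ y → ∃ ψ : Z →+ UnitAddCircle, Continuous ψ ∧ ψ x ≠ ψ y)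
    (hW : ∀ x y : W, x ≠ y → ∃ ψ : W →+ UnitAddCircle, Continuous ψ ∧ ψ x ≠ ψ y)
    (hα : ∀ ψ : Z →+ UnitAddCircle, Continuous ψ → ψ ≠ 0 → ∀ n : ℕ, 0 < n → n • ψ α ≠ 0)
    (hdiv : ∀ ψ : Z →+ UnitAddCircle, ∀ n : ℕ, 0 < n → n • ψ = 0 → ψ = 0)
    (hκ : ∀ ω : Z × W →+ UnitAddCircle, Continuous ω →
      Tendsto (cesaro fun n => expCircle (n ^ 2 • ω (α, β))) atTop (𝓝 (∫ w, expCircle (ω w) ∂κ)))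
    {H : (Z × Z) × (Z × Z) × (Z × Z) × W → ℝ} (hH : Continuous H) :
    Tendsto (fun N => ∫ v, H v ∂(orbitMeasure m α β N)) atTop
      (𝓝 (∫ v, H v ∂(progressionMeasure m κ))) := by
  have hZ2 := exists_character_separating_prod hZ hZ
  refine tendsto_integral_of_characters (exists_character_separating_prod hZ2
    (exists_character_separating_prod hZ2 (exists_character_separating_prod hZ2 hW)))
    (fun N => ?_) (by simp) (tendsto_integral_character_orbitMeasure hα hdiv hκ) hH
  exact ENNReal.toReal_le_of_le_ofReal zero_le_one (by simpa using orbitMeasure_univ_le m α β N)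

theorem AffineJoining.map_snd_measure {d r : ℕ} (Γ : AffineJoining (Torus d) (Torus r)) :
    Γ.measure.map Prod.snd = volume := by
  rw [AffineJoining.measure, Measure.map_finset_sum measurable_snd.aemeasurable]
  simp only [Measure.map_smul, Γ.map_snd_cosetHaar volume]
  rw [← Finset.sum_smul, ← ENNReal.ofReal_sum_of_nonneg fun j _ => (Γ.c_mem j).1, Γ.c_sum,
    ENNReal.ofReal_one, one_smul]

/-- The convolution along an affine joining, computed with a measurable version of the weight. -/
lemma AffineJoining.conv_eq_integral {d r : ℕ} (Γ : AffineJoining (Torus d) (Torus r))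
    {f : Torus d × Torus d → ℝ} (hf : Measurable f) {C : ℝ} (hC : ∀ p, |f p| ≤ C)
    {g g' : Torus r → ℝ} (hg' : Measurable g') {M : ℝ} (hM : ∀ x, |g' x| ≤ M)
    (hgg' : g =ᵐ[volume] g') (p : Torus d × Torus d) :
    Γ.conv f g p = ∫ w, f (p.1, p.2 + 2 • w.1) * g' w.2 ∂Γ.measure := by
  have hcongr : Γ.conv f g p = Γ.integral fun w => f (p.1, p.2 + 2 • w.1) * g' w.2 := by
    unfold AffineJoining.conv AffineJoining.integral
    refine Finset.sum_congr rfl fun j _ => ?_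
    congr 1
    refine integral_congr_ae ?_
    have h1 : g =ᵐ[(cosetHaar Γ.base Γ.isJoining.isClosed (Γ.shift j)).map Prod.snd] g' := by
      rwa [Γ.map_snd_cosetHaar volume j]
    filter_upwards [ae_of_ae_map measurable_snd.aemeasurable h1] with w hw
    rw [hw]
  rw [hcongr, Γ.integral_eq fun j => ?_]
  have hm : Measurable fun w : Torus d × Torus r => (p.1, p.2 + 2 • w.1) :=
    (show Continuous fun w : Torus d × Torus r => (p.1, p.2 + 2 • w.1) by fun_prop).measurable
  refine Integrable.of_bound ((hf.comp hm).mul (hg'.comp measurable_snd)).aestronglyMeasurable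
    (C * M) (.of_forall fun w => ?_)
  rw [norm_mul]
  exact mul_le_mul (hC _) (hM _) (norm_nonneg _) ((abs_nonneg _).trans (hC p))

theorem proposition11p1 (d r : ℕ) (α : Torus d) (β : Torus r)
    (hα : Generates α) (hβ : Generates β) :
    ∃ Γ : AffineJoining (Torus d) (Torus r),
      ∀ g : Torus r → ℝ, RiemannIntegrableOnTorus g →
      ∀ f : Torus d × Torus d → ℝ, Measurable f → (∃ C : ℝ, ∀ p, |f p| ≤ C) →
        Tendsto
          (fun N : ℕ => (1 / (N : ℝ)) * ∑ n ∈ Finset.Icc 1 N,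
            g ((n ^ 2) • β) *
              ∫ p : Torus d × Torus d,
                f p * f ((weylMap α)^[n] p) * f ((weylMap α)^[2 * n] p))
          atTop
          (𝓝 (∫ y : Torus d, ∫ x : Torus d, ∫ t : Torus d, ∫ s : Torus d,
            f (x, y) * f (x + s, y + t) * Γ.conv f g (x + 2 • s, y + 2 • t))) := by
  obtain ⟨q, hq, htor⟩ := exists_torsion_exponent_characters (α, β)
  set Γ := squaresJoining α β hα hβ q hq
  refine ⟨Γ, fun g hg f hf ⟨C, hC⟩ => ?_⟩
  obtain ⟨M, hM⟩ := hg.exists_bound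
  obtain ⟨g', hg'm, hg'M, hgg'⟩ := exists_measurable_version
    (aemeasurable_of_ae_continuousAt hM hg.ae_continuousAt) hM
  have hlim : ∀ H : (Torus d × Torus d) × (Torus d × Torus d) × (Torus d × Torus d) × Torus r → ℝ,
      Continuous H → Tendsto (fun N => ∫ v, H v ∂(orbitMeasure volume α β N)) atTop
        (𝓝 (∫ v, H v ∂(progressionMeasure volume Γ.measure))) := fun H hH =>
    tendsto_integral_orbitMeasure_of_characters exists_character_separating_torus
      exists_character_separating_torus (fun ψ hψ h0 => nsmul_apply_generator_ne_zero hα hψ h0)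
      (fun ψ n hn h => addMonoidHom_torus_eq_zero_of_nsmul hn ψ fun x => DFunLike.congr_fun h x)
      (tendsto_cesaro_squaresJoining hα hβ hq htor) hH
  have key := tendsto_weighted_average hlim Γ.map_snd_measure hf hC
    (fun ε hε => exists_continuous_between hM hg.ae_continuousAt hε) hg'm hg'M hgg'
  have hC0 : 0 ≤ C := (abs_nonneg _).trans (hC 0)
  rw [integral_progressionMeasure (C := C * C * C * M)] at key
  -- The innermost integral over `w` of the last two factors is the convolution `Γ.conv f g`,
  -- evaluated with the measurable version `g'`.
  · refine Eq.subst (motive := fun L => Tendsto _ atTop (𝓝 L)) ?_ key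
    refine integral_congr_ae (.of_forall fun y => integral_congr_ae (.of_forall fun x =>
      integral_congr_ae (.of_forall fun t => integral_congr_ae (.of_forall fun s => ?_))))
    simp only [progressionPoint]
    rw [Γ.conv_eq_integral hf hC hg'm hg'M hgg', ← integral_const_mul]
    simp only [mul_assoc]
  · exact (((hf.comp measurable_fst).mul (hf.comp measurable_snd.fst)).mul
      (hf.comp measurable_snd.snd.fst)).mul (hg'm.comp measurable_snd.snd.snd)
  · intro v
    rw [abs_mul, abs_mul, abs_mul]
    gcongr <;> first | exact hC _ | exact hg'M _

end Main
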